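/- **Setting.** The Pauli group on a finite set of qubits consists of the operators $i^k\bigotimes_q\sigma_q$ with $\sigma_q\in\{I,X,Y,Z\}$; a Clifford is a unitary that conjugates Paulis to Paulis; a Pauli-square-root Clifford (PSC) is a non-Pauli Clifford whose square is a Pauli. Let $g_1,\dots,g_m$ be Pauli strings on $n$ data qubits (the measured stabilizer generators), and let $w_c$ and $w_q$ be the maximum row and column weights of the associated parity-check matrix, i.e. the largest weight of a $g_i$ and the largest number of $g_i$ acting nontrivially on a single qubit. Let $\bar U=\bigotimes_{i=1}^{\ell}V_i$ be a transversal PSC on the data qubits: the $V_i$ are PSCs with pairwise disjoint supports. Assume that every $V_i$ acts on at most $c$ qubits and that $\bar U^2=I$. A standard (single-ancilla, non-fault-tolerant) protocol with $r=r_S+r_L$ rounds is a circuit consisting of $r_S$ stabilizer rounds and $r_L$ PSC rounds in an arbitrary order. A stabilizer round measures a subset of the $g_i$, each with its own ancilla, which controls one controlled-Pauli gate for each qubit in the support of $g_i$. A PSC round measures $\bar U$ with one ancilla, which controls the gates $C(V_1),\dots,C(V_\ell)$. The gates within a round may be in any order, ancillas are never reused, and all measurements are postponed to the end. **Theorem.**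 For every $c$ there is a constant $K$, depending only on $c$, such that for every such protocol with $r\ge 1$ and $w_q\ge 1$ the following holds. Let a single-qubit Pauli error $E$ occur on any data or ancilla qubit at any time (before the first gate, between two consecutive gates, or after the last gate), and write the circuit as $BA$, where $A$ consists of the gates before the error and $B$ of those after it. Then $$B\,E\,A \;=\; C_{\mathrm{prop}}\,B\,A,$$ where $C_{\mathrm{prop}}$ is a Clifford and is a product of at most $K\,r^2\,w_q\,(w_c+\ell)$ Clifford gates, each acting on one or two qubits. -/

import Mathlib

noncomputable section

/-! Linear operators on a finite register of qubits. -/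

/-- Linear operators on the register whose qubits are labelled by `Q`, as matrices in the
computational basis (a basis state is a bit assignment `Q → Fin 2`). -/
abbrev QOp (Q : Type) : Type := Matrix (Q → Fin 2) (Q → Fin 2) ℂ

/-- Labels of the four single-qubit Pauli matrices. -/
inductive Pauli1 : Type where
  | I : Pauli1
  | X : Pauli1
  | Y : Pauli1
  | Z : Pauli1
  deriving DecidableEq

/-- The single-qubit Pauli matrices. -/
def Pauli1.mat : Pauli1 → Matrix (Fin 2) (Fin 2) ℂ
  | Pauli1.I => !![1, 0; 0, 1]
  | Pauli1.X => !![0, 1; 1, 0]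
  | Pauli1.Y => !![0, -Complex.I; Complex.I, 0]
  | Pauli1.Z => !![1, 0; 0, -1]

section Register

variable {Q : Type} [Fintype Q] [DecidableEq Q]

/-- The Pauli string `⨂_q p q`. -/
def pauliString (p : Q → Pauli1) : QOp Q :=
  fun x y => ∏ q, (p q).mat (x q) (y q)

/-- The Pauli matrix `s` on qubit `q`, the identity on all other qubits. -/
def pauliAt (q : Q) (s : Pauli1) : QOp Q :=
  pauliString (Function.update (fun _ => Pauli1.I) q s)

/-- Membership in the Pauli group: a Pauli string times a power of the imaginary unit. -/
def IsPauli (A : QOp Q) : Prop :=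
  ∃ (k : ℕ) (p : Q → Pauli1), A = Complex.I ^ k • pauliString p

/-- Membership in the Clifford group: a unitary that conjugates Paulis to Paulis. -/
def IsClifford (A : QOp Q) : Prop :=
  A ∈ Matrix.unitaryGroup (Q → Fin 2) ℂ ∧
    ∀ P : QOp Q, IsPauli P → IsPauli (A * P * A.conjTranspose)

/-- Pauli-square-root Clifford (PSC): a non-Pauli Clifford whose square is a Pauli. -/
def IsPSC (A : QOp Q) : Prop :=
  IsClifford A ∧ ¬ IsPauli A ∧ IsPauli (A * A)

/-- The operator `B` applied to the qubits `f 0, f 1, …` of the register, tensored with the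
identity on all remaining qubits. -/
def embedOp {k : ℕ} (f : Fin k ↪ Q) (B : QOp (Fin k)) : QOp Q := by
  classical
  exact fun x y =>
    if ∀ q, q ∉ Set.range f → x q = y q then B (fun j => x (f j)) (fun j => y (f j)) else 0

/-- The projector onto the basis states in which qubit `a` has value `b`. -/
def bitProj (a : Q) (b : Fin 2) : QOp Q :=
  Matrix.diagonal fun x => if x a = b then 1 else 0

/-- The controlled gate `|0⟩⟨0|_a ⊗ 1 + |1⟩⟨1|_a ⊗ A` with control qubit `a`
(used only for operators `A` that act trivially on the qubit `a`). -/
def ctrl (a : Q) (A : QOp Q) : QOp Q :=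
  bitProj a 0 + bitProj a 1 * A

/-- `A` is a Clifford gate acting on one or two qubits of the register. -/
def IsOneTwoQubitClifford (A : QOp Q) : Prop :=
  ∃ (k : ℕ) (f : Fin k ↪ Q) (B : QOp (Fin k)),
    1 ≤ k ∧ k ≤ 2 ∧ IsClifford B ∧ A = embedOp f B

/-- The unitary implemented by a sequence of gates, the head of the list being applied first. -/
def evolve (L : List (QOp Q)) : QOp Q := L.reverse.prod

end Register

/-! Standard (single-ancilla, non-fault-tolerant) measurement protocols. -/

/-- A transversal PSC `⨂_i V i` with `ℓ` tensor factors on `n` data qubits: the factor `V i` is a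
PSC on `k i` qubits, which is applied to the data qubits `place i 0, place i 1, …`, and
different factors act on disjoint sets of qubits. -/
structure TransversalPSC (n ℓ : ℕ) where
  k : Fin ℓ → ℕ
  place : (i : Fin ℓ) → Fin (k i) ↪ Fin n
  V : (i : Fin ℓ) → QOp (Fin (k i))
  psc : ∀ i, IsPSC (V i)
  disjoint : ∀ i j, i ≠ j → ∀ a b, place i a ≠ place j b

/-- The operator `⨂_i V i` on the data register. -/
def TransversalPSC.op {n ℓ : ℕ} (U : TransversalPSC n ℓ) : QOp (Fin n) :=
  (List.ofFn fun i => embedOp (U.place i) (U.V i)).prod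

/-- A measurement round, given by the order in time of its gates. In a stabilizer round the entry
`(i, q)` is the controlled-Pauli gate of the `i`-th check on the data qubit `q`; in a PSC round
the entry `j` is the controlled gate of the `j`-th tensor factor. -/
inductive Round (n m ℓ : ℕ) : Type where
  | stab (L : List (Fin m × Fin n)) : Round n m ℓ
  | psc (L : List (Fin ℓ)) : Round n m ℓ

/-- A stabilizer round measures a subset `T` of the checks: each `i ∈ T` contributes exactly one
controlled-Pauli gate for each qubit in the support of the check. A PSC round contains exactly one
controlled gate for each tensor factor. The order of the gates is arbitrary. -/
def Round.Valid {n m ℓ : ℕ} (check : Fin m → Fin n → Pauli1) : Round n m ℓ → Prop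
  | Round.stab L => L.Nodup ∧
      ∃ T : Finset (Fin m), ∀ i q, (i, q) ∈ L ↔ i ∈ T ∧ check i q ≠ Pauli1.I
  | Round.psc L => L.Nodup ∧ ∀ j, j ∈ L

/-- Whether a round is a stabilizer round. -/
def Round.isStab {n m ℓ : ℕ} : Round n m ℓ → Bool
  | Round.stab _ => true
  | Round.psc _ => false

/-- A standard protocol of `r` rounds on `n` data qubits. The measured stabilizer generators are
the Pauli strings `⨂_q check i q` for `i : Fin m`, and `U` is the measured transversal PSC. -/
structure StandardProtocol (n m ℓ r : ℕ) where
  check : Fin m → Fin n → Pauli1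
  U : TransversalPSC n ℓ
  round : Fin r → Round n m ℓ
  valid : ∀ t, (round t).Valid check

/-- The qubits: `n` data qubits; for the round `t`, one fresh ancilla `(t, some i)` for each check
`i` and one fresh ancilla `(t, none)` for the PSC. Ancillas are never reused, and those that the
round `t` does not need take part in no gate. -/
abbrev ProtocolQubit (n m r : ℕ) : Type := Fin n ⊕ (Fin r × Option (Fin m))

namespace StandardProtocol

variable {n m ℓ r : ℕ}

/-- The gates of round `t` in their order in time. -/
def roundGates (p : StandardProtocol n m ℓ r) (t : Fin r) : List (QOp (ProtocolQubit n m r)) :=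
  match p.round t with
  | Round.stab L => L.map fun e =>
      ctrl (Sum.inr (t, some e.1)) (pauliAt (Sum.inl e.2) (p.check e.1 e.2))
  | Round.psc L => L.map fun j =>
      ctrl (Sum.inr (t, none))
        (embedOp ((p.U.place j).trans Function.Embedding.inl) (p.U.V j))

/-- All gates of the protocol in their order in time (the measurements of the ancillas are
postponed to the end). -/
def gates (p : StandardProtocol n m ℓ r) : List (QOp (ProtocolQubit n m r)) :=
  (List.finRange r).flatMap p.roundGates

/-- The number of rounds of stabilizer measurements. -/
def rS (p : StandardProtocol n m ℓ r) : ℕ :=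
  (Finset.univ.filter fun t => (p.round t).isStab = true).card

/-- The number of rounds of PSC measurements. -/
def rL (p : StandardProtocol n m ℓ r) : ℕ :=
  (Finset.univ.filter fun t => (p.round t).isStab = false).card

/-- The maximum row weight of the parity-check matrix: the largest weight of a check. -/
def wc (p : StandardProtocol n m ℓ r) : ℕ :=
  Finset.univ.sup fun i => (Finset.univ.filter fun q => p.check i q ≠ Pauli1.I).card

/-- The maximum column weight of the parity-check matrix: the largest number of checks that act
nontrivially on one data qubit. -/
def wq (p : StandardProtocol n m ℓ r) : ℕ :=
  Finset.univ.sup fun q => (Finset.univ.filter fun i => p.check i q ≠ Pauli1.I).card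

end StandardProtocol

end

set_option linter.unusedSectionVars false

noncomputable section

/-! ### The Pauli group -/

/-! Only the gates after the error matter: a cheap Clifford `E'` with `B E = E' B` is wanted. A
controlled `V_j` need not be Clifford, so neither Cliffordness nor the cost of `E'` follows from
plain conjugation.

Algebraic core. Since the transversal operator squares to one, each `V = V_j` has scalar square
(`TransversalPSC.exists_sq_eq`). For a single-qubit Pauli `P` in its support, the commutator `R = V
P V† P` is a Pauli, and the scalar square gives `V R V† = R† = ±R` (`IsClifford.exists_commutator`).
Commutators with `V` therefore end in a sign after one step.

Data errors. Fix the support of one factor as a block and let `W` be a Pauli on it or `V` itself.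
While passing through the circuit the error keeps the form `W D`. Each controlled Pauli or
controlled `V` with control `a` adds to `D` a controlled Pauli `ctrl a R`, and, because the older
factors of `D` commute with the new target only up to `Z` on their ancillas, phase gates between
ancillas (`QubitBlock.IsHead.mul_ctrl_pauli`, `QubitBlock.IsHead.mul_ctrl_V`). Passing a controlled
Pauli is conjugation by a cheap Clifford. Passing a controlled `V` costs one controlled Pauli on the
block and at most as many controlled `Z` gates as block gates were met before. There are at most `r
c w_q` gates of the first kind and `r` of the second, which gives `O(r² w_q)`.

Ancilla errors. `Z` on an ancilla commutes with all gates. `X` passing `ctrl a A` leaves the data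
error `A` and a phase gate on `a` (`pauliAt_X_mul_ctrl`). At most `w_c + ℓ` gates share a control,
and each `A` is a block error, so the two counts multiply.

The remaining work is to count gates: a Clifford on `k` qubits is up to phase a product of `O(k)`
Pauli rotations (`IsClifford.eq_smul_prod`), each of cost linear in its weight. -/

/-- The product of two Pauli labels, up to phase. -/
def Pauli1.mul : Pauli1 → Pauli1 → Pauli1
  | Pauli1.I, s => s
  | s, Pauli1.I => s
  | Pauli1.X, Pauli1.X => Pauli1.I
  | Pauli1.Y, Pauli1.Y => Pauli1.I
  | Pauli1.Z, Pauli1.Z => Pauli1.I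
  | Pauli1.X, Pauli1.Y => Pauli1.Z
  | Pauli1.Y, Pauli1.X => Pauli1.Z
  | Pauli1.X, Pauli1.Z => Pauli1.Y
  | Pauli1.Z, Pauli1.X => Pauli1.Y
  | Pauli1.Y, Pauli1.Z => Pauli1.X
  | Pauli1.Z, Pauli1.Y => Pauli1.X

/-- The commutation sign of two Pauli labels. -/
def Pauli1.sgn (s t : Pauli1) : ℤ :=
  if s = Pauli1.I ∨ t = Pauli1.I ∨ s = t then 1 else -1

namespace Pauli1

theorem mat_mul (s t : Pauli1) : ∃ k : ℕ, s.mat * t.mat = Complex.I ^ k • (s.mul t).mat := by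
  cases s <;> cases t
  case I.I | I.X | I.Y | I.Z | X.I | Y.I | Z.I | X.X | Y.Y | Z.Z =>
    exact ⟨0, by ext i j; fin_cases i <;> fin_cases j <;> simp [mat, mul, Matrix.mul_apply]⟩
  case X.Y | Y.Z | Z.X =>
    exact ⟨1, by ext i j; fin_cases i <;> fin_cases j <;> simp [mat, mul, Matrix.mul_apply]⟩
  case Y.X | Z.Y | X.Z =>
    exact ⟨3, by ext i j; fin_cases i <;> fin_cases j <;>
      simp [mat, mul, Matrix.mul_apply, pow_succ]⟩

theorem mat_comm (s t : Pauli1) : s.mat * t.mat = (sgn s t : ℂ) • (t.mat * s.mat) := by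
  cases s <;> cases t <;> ext i j <;> fin_cases i <;> fin_cases j <;>
    simp [mat, sgn, Matrix.mul_apply]

theorem mat_conjTranspose (s : Pauli1) : s.mat.conjTranspose = s.mat := by
  cases s <;> ext i j <;> fin_cases i <;> fin_cases j <;> simp [mat]

theorem mat_sq (s : Pauli1) : s.mat * s.mat = 1 := by
  cases s <;> ext i j <;> fin_cases i <;> fin_cases j <;> simp [mat, Matrix.mul_apply]

theorem mat_I : Pauli1.I.mat = 1 := by
  ext i j; fin_cases i <;> fin_cases j <;> simp [mat]

theorem sgn_eq (s t : Pauli1) : sgn s t = 1 ∨ sgn s t = -1 := by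
  unfold sgn; split_ifs <;> simp

@[simp] theorem sgn_I_left (t : Pauli1) : sgn Pauli1.I t = 1 := by simp [sgn]

@[simp] theorem sgn_I_right (t : Pauli1) : sgn t Pauli1.I = 1 := by simp [sgn]

@[simp] theorem sgn_self (t : Pauli1) : sgn t t = 1 := by simp [sgn]

@[simp] theorem mul_self (t : Pauli1) : mul t t = Pauli1.I := by cases t <;> rfl

@[simp] theorem I_mul (t : Pauli1) : mul Pauli1.I t = t := by cases t <;> rfl

theorem exists_sgn_neg {s : Pauli1} (h : s ≠ Pauli1.I) : ∃ t, sgn t s = -1 := by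
  cases s
  · exact absurd rfl h
  · exact ⟨Pauli1.Z, by simp [sgn]⟩
  · exact ⟨Pauli1.Z, by simp [sgn]⟩
  · exact ⟨Pauli1.X, by simp [sgn]⟩

end Pauli1

section Register

variable {Q : Type} [Fintype Q] [DecidableEq Q]

/-- The tensor product of one-qubit operators. -/
def tensorOp (M : Q → Matrix (Fin 2) (Fin 2) ℂ) : QOp Q :=
  fun x y => ∏ q, M q (x q) (y q)

theorem tensorOp_mul (M N : Q → Matrix (Fin 2) (Fin 2) ℂ) :
    tensorOp M * tensorOp N = tensorOp fun q => M q * N q := by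
  ext x y
  simp only [tensorOp, Matrix.mul_apply]
  rw [Finset.prod_univ_sum]
  simp [Fintype.piFinset_univ, Finset.prod_mul_distrib]

theorem tensorOp_smul (a : Q → ℂ) (M : Q → Matrix (Fin 2) (Fin 2) ℂ) :
    tensorOp (fun q => a q • M q) = (∏ q, a q) • tensorOp M := by
  ext x y
  simp [tensorOp, Finset.prod_mul_distrib]

theorem tensorOp_one : tensorOp (fun _ : Q => (1 : Matrix (Fin 2) (Fin 2) ℂ)) = 1 := by
  ext x y
  simp only [tensorOp, Matrix.one_apply, Finset.prod_ite_zero, Finset.prod_const_one]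
  simp [funext_iff]

theorem pauliString_eq_tensorOp (p : Q → Pauli1) :
    pauliString p = tensorOp fun q => (p q).mat := rfl

theorem pauliString_I : pauliString (fun _ : Q => Pauli1.I) = 1 := by
  simp [pauliString_eq_tensorOp, Pauli1.mat_I, tensorOp_one]

theorem pauliString_mul (p p' : Q → Pauli1) :
    ∃ k : ℕ, pauliString p * pauliString p' =
      Complex.I ^ k • pauliString fun q => (p q).mul (p' q) := by
  choose k hk using fun q => Pauli1.mat_mul (p q) (p' q)
  refine ⟨∑ q, k q, ?_⟩
  simp only [pauliString_eq_tensorOp, tensorOp_mul, hk, tensorOp_smul,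
    Finset.prod_pow_eq_pow_sum]

/-- The commutation sign of two Pauli strings. -/
def stringSgn (p p' : Q → Pauli1) : ℤ := ∏ q, (p q).sgn (p' q)

theorem pauliString_comm (p p' : Q → Pauli1) :
    pauliString p * pauliString p' =
      (stringSgn p p' : ℂ) • (pauliString p' * pauliString p) := by
  simp only [pauliString_eq_tensorOp, tensorOp_mul]
  simp_rw [fun q => Pauli1.mat_comm (p q) (p' q)]
  rw [tensorOp_smul]
  simp [stringSgn]

theorem stringSgn_eq (p p' : Q → Pauli1) : stringSgn p p' = 1 ∨ stringSgn p p' = -1 := by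
  unfold stringSgn
  refine Finset.prod_induction _ (fun a : ℤ => a = 1 ∨ a = -1) ?_ (Or.inl rfl)
    fun q _ => Pauli1.sgn_eq _ _
  rintro a b (rfl | rfl) (rfl | rfl) <;> simp

theorem stringSgn_update (q : Q) (s : Pauli1) (p : Q → Pauli1) :
    stringSgn (Function.update (fun _ => Pauli1.I) q s) p = s.sgn (p q) := by
  unfold stringSgn
  rw [Finset.prod_eq_single q]
  · simp
  · intro b _ hb
    simp [Function.update_of_ne hb]
  · simp

theorem pauliAt_mul_pauliString (q : Q) (s : Pauli1) (p : Q → Pauli1) :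
    pauliAt q s * pauliString p = (s.sgn (p q) : ℂ) • (pauliString p * pauliAt q s) := by
  rw [pauliAt, pauliString_comm, stringSgn_update]

theorem pauliString_conjTranspose (p : Q → Pauli1) :
    (pauliString p).conjTranspose = pauliString p := by
  ext x y
  simp only [Matrix.conjTranspose_apply, pauliString, star_prod]
  refine Finset.prod_congr rfl fun q _ => ?_
  rw [← Matrix.conjTranspose_apply, Pauli1.mat_conjTranspose]

theorem pauliString_sq (p : Q → Pauli1) : pauliString p * pauliString p = 1 := by
  simp [pauliString_eq_tensorOp, tensorOp_mul, Pauli1.mat_sq, tensorOp_one]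

theorem pauliAt_sq (q : Q) (s : Pauli1) : pauliAt q s * pauliAt q s = 1 := pauliString_sq _

theorem pauliAt_I (q : Q) : pauliAt q Pauli1.I = 1 := by
  rw [pauliAt, ← pauliString_I]
  congr 1
  exact Function.update_eq_self q fun _ => Pauli1.I

theorem pauliAt_comm (q : Q) (s t : Pauli1) :
    pauliAt q s * pauliAt q t = (s.sgn t : ℂ) • (pauliAt q t * pauliAt q s) := by
  have := pauliAt_mul_pauliString q s (Function.update (fun _ => Pauli1.I) q t)
  simpa [pauliAt] using this

theorem pauliAt_commute {q q' : Q} (h : q ≠ q') (s t : Pauli1) :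
    Commute (pauliAt q s) (pauliAt q' t) := by
  have := pauliAt_mul_pauliString q s (Function.update (fun _ => Pauli1.I) q' t)
  simpa [pauliAt, Function.update_of_ne h, Commute, SemiconjBy] using this

/-- A member of the Pauli group that acts trivially outside the set `B` of qubits. -/
def IsPauliOn (B : Finset Q) (A : QOp Q) : Prop :=
  ∃ (k : ℕ) (p : Q → Pauli1), A = Complex.I ^ k • pauliString p ∧ ∀ q ∉ B, p q = Pauli1.I

theorem IsPauliOn.isPauli {B : Finset Q} {A : QOp Q} (h : IsPauliOn B A) : IsPauli A := by
  obtain ⟨k, p, h, -⟩ := h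
  exact ⟨k, p, h⟩

theorem IsPauli.isPauliOn {A : QOp Q} (h : IsPauli A) : IsPauliOn Finset.univ A := by
  obtain ⟨k, p, h⟩ := h
  exact ⟨k, p, h, by simp⟩

theorem IsPauliOn.mono {B B' : Finset Q} {A : QOp Q} (h : IsPauliOn B A) (hB : B ⊆ B') :
    IsPauliOn B' A := by
  obtain ⟨k, p, h, hp⟩ := h
  exact ⟨k, p, h, fun q hq => hp q fun h => hq (hB h)⟩

theorem IsPauliOn.mul {B : Finset Q} {A A' : QOp Q} (h : IsPauliOn B A) (h' : IsPauliOn B A') :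
    IsPauliOn B (A * A') := by
  obtain ⟨k, p, rfl, hp⟩ := h
  obtain ⟨k', p', rfl, hp'⟩ := h'
  obtain ⟨l, hl⟩ := pauliString_mul p p'
  refine ⟨k + k' + l, fun q => (p q).mul (p' q), ?_, fun q hq => ?_⟩
  · rw [smul_mul_smul_comm, hl, smul_smul, ← pow_add, ← pow_add]
  · simp [hp q hq, hp' q hq]

theorem IsPauliOn.smul {B : Finset Q} {A : QOp Q} (h : IsPauliOn B A) (k : ℕ) :
    IsPauliOn B (Complex.I ^ k • A) := by
  obtain ⟨l, p, rfl, hp⟩ := h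
  exact ⟨k + l, p, by rw [smul_smul, ← pow_add], hp⟩

theorem IsPauliOn.neg {B : Finset Q} {A : QOp Q} (h : IsPauliOn B A) : IsPauliOn B (-A) := by
  simpa using h.smul 2

theorem IsPauliOn.I_smul {B : Finset Q} {A : QOp Q} (h : IsPauliOn B A) :
    IsPauliOn B (Complex.I • A) := by
  simpa using h.smul 1

theorem IsPauliOn.neg_I_smul {B : Finset Q} {A : QOp Q} (h : IsPauliOn B A) :
    IsPauliOn B (-Complex.I • A) := by
  rw [neg_smul]
  exact h.I_smul.neg

theorem isPauliOn_pauliAt (q : Q) (s : Pauli1) : IsPauliOn {q} (pauliAt q s) :=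
  ⟨0, _, by rw [pow_zero, one_smul, pauliAt], fun q' hq' => by
    rw [Function.update_of_ne (by simpa using hq')]⟩

theorem isPauliOn_one (B : Finset Q) : IsPauliOn B (1 : QOp Q) :=
  ⟨0, fun _ => Pauli1.I, by simp [pauliString_I], fun _ _ => rfl⟩

theorem IsPauli.mul {A A' : QOp Q} (h : IsPauli A) (h' : IsPauli A') : IsPauli (A * A') :=
  (h.isPauliOn.mul h'.isPauliOn).isPauli

theorem isPauli_pauliAt (q : Q) (s : Pauli1) : IsPauli (pauliAt q s) :=
  (isPauliOn_pauliAt q s).isPauli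

theorem IsPauli.comm {A A' : QOp Q} (h : IsPauli A) (h' : IsPauli A') :
    A * A' = A' * A ∨ A * A' = -(A' * A) := by
  obtain ⟨k, p, rfl⟩ := h
  obtain ⟨k', p', rfl⟩ := h'
  simp only [smul_mul_smul_comm]
  rw [pauliString_comm, mul_comm]
  rcases stringSgn_eq p p' with h | h <;> simp [h]

theorem IsPauli.mul_conjTranspose {A : QOp Q} (h : IsPauli A) : A * A.conjTranspose = 1 := by
  obtain ⟨k, p, rfl⟩ := h
  rw [Matrix.conjTranspose_smul, smul_mul_smul_comm, pauliString_conjTranspose, pauliString_sq]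
  simp [← mul_pow]

theorem IsPauli.conjTranspose_mul {A : QOp Q} (h : IsPauli A) : A.conjTranspose * A = 1 :=
  mul_eq_one_comm.mp h.mul_conjTranspose

/-- The adjoint of a Pauli is plus or minus itself. -/
theorem IsPauli.conjTranspose_eq {A : QOp Q} (h : IsPauli A) :
    A.conjTranspose = A ∨ A.conjTranspose = -A := by
  obtain ⟨k, p, rfl⟩ := h
  rw [Matrix.conjTranspose_smul, pauliString_conjTranspose]
  have : star (Complex.I ^ k) = (-1) ^ k * Complex.I ^ k := by
    rw [star_pow, ← mul_pow]
    simp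
  rw [this]
  rcases neg_one_pow_eq_or ℂ k with h | h <;> simp [h]

theorem IsPauli.ne_zero {A : QOp Q} (h : IsPauli A) : A ≠ 0 := by
  rintro rfl
  simpa using h.mul_conjTranspose

theorem pauliAt_Y (q : Q) :
    pauliAt q Pauli1.Y = Complex.I • (pauliAt q Pauli1.X * pauliAt q Pauli1.Z) := by
  have : ∀ s, pauliAt q s = tensorOp (Function.update (fun _ => 1) q s.mat) := by
    intro s
    rw [pauliAt, pauliString_eq_tensorOp]
    congr 1
    ext1 q'
    by_cases h : q' = q
    · subst h; simp
    · simp [Function.update_of_ne h, Pauli1.mat_I]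
  rw [this, this, this, tensorOp_mul]
  let u (s : Pauli1) : Q → Matrix (Fin 2) (Fin 2) ℂ := Function.update (fun _ => 1) q s.mat
  have h : u Pauli1.Y = fun q' => (Function.update (fun _ : Q => (1 : ℂ)) q Complex.I q') •
      (u Pauli1.X q' * u Pauli1.Z q') := by
    ext1 q'
    by_cases h : q' = q
    · subst h
      ext i j
      fin_cases i <;> fin_cases j <;> simp [u, Pauli1.mat]
    · simp [u, Function.update_of_ne h]
  change tensorOp (u Pauli1.Y) = _
  rw [h, tensorOp_smul]
  congr 1
  rw [Finset.prod_update_of_mem (Finset.mem_univ q)]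
  simp

/-! ### Controlled gates -/

theorem bitProj_add (a : Q) : bitProj a 0 + bitProj a 1 = (1 : QOp Q) := by
  rw [bitProj, bitProj, Matrix.diagonal_add, ← Matrix.diagonal_one]
  congr 1
  ext x
  generalize x a = b
  fin_cases b <;> simp

theorem bitProj_sub (a : Q) : bitProj a 0 - bitProj a 1 = (pauliAt a Pauli1.Z : QOp Q) := by
  ext x y
  simp only [bitProj, Matrix.diagonal_sub, pauliAt, pauliString]
  by_cases h : x = y
  · subst h
    rw [Finset.prod_eq_single a]
    · simp only [Matrix.diagonal_apply_eq, Function.update_self]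
      generalize x a = b
      fin_cases b <;> simp [Pauli1.mat]
    · intro b _ hb
      simp [Function.update_of_ne hb, Pauli1.mat_I]
    · simp
  · rw [Matrix.diagonal_apply_ne _ h]
    obtain ⟨q, hq⟩ := Function.ne_iff.mp h
    symm
    apply Finset.prod_eq_zero (Finset.mem_univ q)
    by_cases hqa : q = a
    · subst hqa
      simp only [Function.update_self]
      revert hq
      generalize x q = b
      generalize y q = b'
      fin_cases b <;> fin_cases b' <;> simp [Pauli1.mat]
    · simp [Function.update_of_ne hqa, Pauli1.mat_I, Matrix.one_apply_ne hq]

theorem bitProj_zero_eq (a : Q) :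
    bitProj a 0 = ((1 / 2 : ℂ)) • (1 + pauliAt a Pauli1.Z : QOp Q) := by
  rw [← bitProj_sub, ← bitProj_add a]
  module

theorem bitProj_one_eq (a : Q) :
    bitProj a 1 = ((1 / 2 : ℂ)) • (1 - pauliAt a Pauli1.Z : QOp Q) := by
  rw [← bitProj_sub, ← bitProj_add a]
  module

theorem bitProj_mul_self (a : Q) (b : Fin 2) :
    bitProj a b * bitProj a b = (bitProj a b : QOp Q) := by
  simp [bitProj, Matrix.diagonal_mul_diagonal]

theorem bitProj_zero_mul_one (a : Q) : bitProj a 0 * bitProj a 1 = (0 : QOp Q) := by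
  simp only [bitProj, Matrix.diagonal_mul_diagonal]
  rw [← Matrix.diagonal_zero]
  congr 1
  ext x
  generalize x a = b
  fin_cases b <;> simp

theorem bitProj_one_mul_zero (a : Q) : bitProj a 1 * bitProj a 0 = (0 : QOp Q) := by
  simp only [bitProj, Matrix.diagonal_mul_diagonal]
  rw [← Matrix.diagonal_zero]
  congr 1
  ext x
  generalize x a = b
  fin_cases b <;> simp

theorem commute_bitProj {a : Q} {A : QOp Q} (h : Commute (pauliAt a Pauli1.Z) A) (b : Fin 2) :
    Commute (bitProj a b) A := by
  fin_cases b
  · simp only [Fin.zero_eta, bitProj_zero_eq]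
    exact ((Commute.one_left A).add_left h).smul_left _
  · simp only [Fin.mk_one, bitProj_one_eq]
    exact ((Commute.one_left A).sub_left h).smul_left _

theorem ctrl_one (a : Q) : ctrl a (1 : QOp Q) = 1 := by
  rw [ctrl, mul_one, bitProj_add]

/-- The product is taken separately on the two control values. Only the left target must commute
with `Z` on the control: this removes the cross term `bitProj a 1 * A * bitProj a 0`. -/
theorem ctrl_mul {a : Q} {A : QOp Q} (h : Commute (pauliAt a Pauli1.Z) A) (B : QOp Q) :
    ctrl a (A * B) = ctrl a A * ctrl a B := by
  have h0 := (commute_bitProj h 0).eq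
  have h1 := (commute_bitProj h 1).eq
  have e1 : bitProj a 1 * A * bitProj a 0 = 0 := by
    rw [h1, mul_assoc, bitProj_one_mul_zero, mul_zero]
  have e2 : bitProj a 1 * A * (bitProj a 1 * B) = bitProj a 1 * (A * B) := by
    rw [h1, mul_assoc, ← mul_assoc (bitProj a 1), bitProj_mul_self, ← mul_assoc, ← h1, mul_assoc]
  have e3 : bitProj a 0 * (bitProj a 1 * B) = 0 := by
    rw [← mul_assoc, bitProj_zero_mul_one, zero_mul]
  simp only [ctrl, add_mul, mul_add]
  rw [e1, e2, e3, bitProj_mul_self]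
  abel

/-- Phase kickback: a sign on the branch with control one is `Z` on the control. This turns
anticommutation of targets into ancilla `Z` operators. -/
theorem ctrl_neg (a : Q) (A : QOp Q) : ctrl a (-A) = pauliAt a Pauli1.Z * ctrl a A := by
  rw [← bitProj_sub]
  simp only [ctrl, sub_mul, mul_add, ← mul_assoc, bitProj_mul_self, bitProj_zero_mul_one,
    bitProj_one_mul_zero]
  simp [sub_eq_add_neg]

/-- An operator commutes with a controlled gate if it commutes with the control and the target. -/
theorem commute_ctrl {a : Q} {A X : QOp Q} (h : Commute (pauliAt a Pauli1.Z) X)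
    (h' : Commute A X) : Commute (ctrl a A) X :=
  (commute_bitProj h 0).add_left ((commute_bitProj h 1).mul_left h')

/-- The degenerate case of equal control and target; it allows `ctrl b (zString S)` to be counted
without assuming `b ∉ S`. -/
theorem ctrl_pauliZ_self (a : Q) : ctrl a (pauliAt a Pauli1.Z) = (pauliAt a Pauli1.Z : QOp Q) := by
  rw [ctrl, ← bitProj_sub, mul_sub, bitProj_one_mul_zero, bitProj_mul_self]
  abel

/-- `X` swaps the control values, so afterwards `A` has acted on the wrong branch. A further `A` on
both branches repairs this, except that the branch with control one then carries `A * A = u`, which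
the controlled `u⁻¹` removes. -/
theorem pauliAt_X_mul_ctrl {a : Q} {A : QOp Q} {u : ℂ} (hu : u ≠ 0) (hA : A * A = u • 1)
    (hZ : Commute (pauliAt a Pauli1.Z) A) (hX : Commute (pauliAt a Pauli1.X) A) :
    ctrl a A * pauliAt a Pauli1.X =
      pauliAt a Pauli1.X * A * ctrl a (u⁻¹ • (1 : QOp Q)) * ctrl a A := by
  have hXZ : pauliAt a Pauli1.Z * pauliAt a Pauli1.X =
      -(pauliAt a Pauli1.X * pauliAt a Pauli1.Z : QOp Q) := by
    rw [pauliAt_comm]; simp [Pauli1.sgn]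
  have h0 : bitProj a 0 * pauliAt a Pauli1.X = (pauliAt a Pauli1.X * bitProj a 1 : QOp Q) := by
    rw [bitProj_zero_eq, bitProj_one_eq, smul_mul_assoc, mul_smul_comm, add_mul, mul_sub, hXZ]
    simp [sub_eq_add_neg]
  have h1 : bitProj a 1 * pauliAt a Pauli1.X = (pauliAt a Pauli1.X * bitProj a 0 : QOp Q) := by
    rw [bitProj_zero_eq, bitProj_one_eq, smul_mul_assoc, mul_smul_comm, sub_mul, mul_add, hXZ]
    simp
  rw [mul_assoc (_ * A), ← ctrl_mul (by simpa using (Commute.one_right _).smul_right u⁻¹)]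
  simp only [ctrl, add_mul, mul_add, smul_mul_assoc, one_mul, mul_smul_comm]
  rw [h0, mul_assoc _ A, ← hX.eq, ← mul_assoc (bitProj a 1), h1]
  rw [mul_assoc _ A (bitProj a 0), ← (commute_bitProj hZ 0).eq]
  have : (pauliAt a Pauli1.X * A * (bitProj a 1 * A) : QOp Q) =
      u • (pauliAt a Pauli1.X * bitProj a 1) := by
    rw [(commute_bitProj hZ 1).eq, mul_assoc, ← mul_assoc A, hA]
    simp
  rw [this, smul_smul, inv_mul_cancel₀ hu, one_smul, add_comm, mul_assoc]

end Register

section Register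

variable {Q : Type} [Fintype Q] [DecidableEq Q]

/-! ### Operators on part of the register -/

section Embed

variable {k : ℕ} (f : Fin k ↪ Q)

theorem embedOp_of_agree (B : QOp (Fin k)) {x y : Q → Fin 2}
    (h : ∀ q, q ∉ Set.range f → x q = y q) :
    embedOp f B x y = B (fun j => x (f j)) fun j => y (f j) := by
  classical
  exact if_pos h

theorem embedOp_of_not_agree (B : QOp (Fin k)) {x y : Q → Fin 2}
    (h : ¬∀ q, q ∉ Set.range f → x q = y q) : embedOp f B x y = 0 := by
  classical
  exact if_neg h

theorem embedOp_add (A B : QOp (Fin k)) : embedOp f (A + B) = embedOp f A + embedOp f B := by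
  ext x y
  by_cases h : ∀ q, q ∉ Set.range f → x q = y q
  · simp [embedOp_of_agree f _ h]
  · simp [embedOp_of_not_agree f _ h]

theorem embedOp_smul (c : ℂ) (A : QOp (Fin k)) : embedOp f (c • A) = c • embedOp f A := by
  ext x y
  by_cases h : ∀ q, q ∉ Set.range f → x q = y q
  · simp [embedOp_of_agree f _ h]
  · simp [embedOp_of_not_agree f _ h]

theorem embedOp_mul (A B : QOp (Fin k)) : embedOp f (A * B) = embedOp f A * embedOp f B := by
  ext x y
  rw [Matrix.mul_apply]
  by_cases h : ∀ q, q ∉ Set.range f → x q = y q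
  · rw [embedOp_of_agree f _ h, Matrix.mul_apply]
    have hext : ∀ (w : Fin k → Fin 2) (q : Q), q ∉ Set.range f → Function.extend f w x q = x q :=
      fun w q hq => Function.extend_apply' _ _ _ hq
    -- Only intermediate states that agree with `x` off the range of `f` contribute; they are
    -- indexed by their bits `w` on the range.
    refine Fintype.sum_of_injective (fun w => Function.extend f w x) ?_ _ _ ?_ ?_
    · intro w w' hw
      ext1 j
      simpa [f.injective.extend_apply] using congrFun hw (f j)
    · intro z hz
      rw [embedOp_of_not_agree, zero_mul]
      intro hxz
      refine hz ⟨fun j => z (f j), ?_⟩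
      ext1 q
      by_cases hq : q ∈ Set.range f
      · obtain ⟨j, rfl⟩ := hq
        simp [f.injective.extend_apply]
      · exact (hext _ q hq).trans (hxz q hq)
    · intro w
      rw [embedOp_of_agree f A fun q hq => (hext w q hq).symm,
        embedOp_of_agree f B fun q hq => (hext w q hq).trans (h q hq)]
      simp [f.injective.extend_apply]
  · rw [embedOp_of_not_agree f _ h]
    symm
    refine Finset.sum_eq_zero fun z _ => ?_
    by_cases hxz : ∀ q, q ∉ Set.range f → x q = z q
    · rw [embedOp_of_not_agree f B, mul_zero]
      exact fun hzy => h fun q hq => (hxz q hq).trans (hzy q hq)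
    · rw [embedOp_of_not_agree f A hxz, zero_mul]

theorem embedOp_pauliString (p : Fin k → Pauli1) :
    embedOp f (pauliString p) = pauliString (Function.extend f p fun _ => Pauli1.I) := by
  ext x y
  by_cases h : ∀ q, q ∉ Set.range f → x q = y q
  · rw [embedOp_of_agree f _ h]
    refine Fintype.prod_of_injective f f.injective _ _ (fun q hq => ?_) fun j => ?_
    · rw [Function.extend_apply' _ _ _ hq, Pauli1.mat_I, h q hq, Matrix.one_apply_eq]
    · rw [f.injective.extend_apply]
  · rw [embedOp_of_not_agree f _ h]
    push Not at h
    obtain ⟨q, hq, hxy⟩ := h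
    symm
    refine Finset.prod_eq_zero (Finset.mem_univ q) ?_
    rw [Function.extend_apply' _ _ _ hq, Pauli1.mat_I, Matrix.one_apply_ne hxy]

theorem embedOp_one : embedOp f (1 : QOp (Fin k)) = 1 := by
  rw [← pauliString_I, embedOp_pauliString, ← pauliString_I]
  congr 1
  ext1 q
  by_cases hq : q ∈ Set.range f
  · obtain ⟨j, rfl⟩ := hq
    rw [f.injective.extend_apply]
  · rw [Function.extend_apply' _ _ _ hq]

theorem embedOp_neg (A : QOp (Fin k)) : embedOp f (-A) = -embedOp f A := by
  simpa using embedOp_smul f (-1) A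

theorem embedOp_pauliAt (j : Fin k) (s : Pauli1) : embedOp f (pauliAt j s) = pauliAt (f j) s := by
  rw [pauliAt, embedOp_pauliString, pauliAt]
  congr 1
  ext1 q
  by_cases hq : q ∈ Set.range f
  · obtain ⟨i, rfl⟩ := hq
    rw [f.injective.extend_apply]
    by_cases hij : i = j
    · subst hij; simp
    · rw [Function.update_of_ne hij, Function.update_of_ne (f.injective.ne hij)]
  · rw [Function.extend_apply' _ _ _ hq, Function.update_of_ne]
    rintro rfl
    exact hq ⟨j, rfl⟩

/-- A Pauli string supported in the range of `f` comes from that range. -/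
theorem pauliString_eq_embedOp {p : Q → Pauli1} (hp : ∀ q, q ∉ Set.range f → p q = Pauli1.I) :
    pauliString p = embedOp f (pauliString fun j => p (f j)) := by
  rw [embedOp_pauliString]
  congr 1
  ext1 q
  by_cases hq : q ∈ Set.range f
  · obtain ⟨j, rfl⟩ := hq
    rw [f.injective.extend_apply]
  · rw [Function.extend_apply' _ _ _ hq, hp q hq]

theorem IsPauli.embedOp {A : QOp (Fin k)} (h : IsPauli A) :
    IsPauliOn (Finset.univ.map f) (embedOp f A) := by
  obtain ⟨l, p, rfl⟩ := h
  refine ⟨l, _, by rw [embedOp_smul, embedOp_pauliString], fun q hq => ?_⟩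
  refine Function.extend_apply' _ _ _ ?_
  rintro ⟨j, rfl⟩
  exact hq (by simp)

theorem embedOp_mul_apply_of_disjoint {l : ℕ} (g : Fin l ↪ Q) (hfg : ∀ i j, f i ≠ g j)
    (A : QOp (Fin k)) (B : QOp (Fin l)) (x y : Q → Fin 2) [Decidable
      (∀ q, q ∉ Set.range f → q ∉ Set.range g → x q = y q)] :
    (embedOp f A * embedOp g B) x y =
      if ∀ q, q ∉ Set.range f → q ∉ Set.range g → x q = y q then
        A (fun j => x (f j)) (fun j => y (f j)) * B (fun j => x (g j)) (fun j => y (g j))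
      else 0 := by
  rw [Matrix.mul_apply]
  split_ifs with h
  · classical
    -- The only intermediate state that contributes: the first factor has already set its own qubits
    -- to `y`, and the others are still at `x`.
    set z : Q → Fin 2 := fun q => if q ∈ Set.range f then y q else x q with hz
    have hxz : ∀ q, q ∉ Set.range f → x q = z q := fun q hq => by simp only [hz, if_neg hq]
    have hzf : ∀ i, z (f i) = y (f i) := fun i => if_pos ⟨i, rfl⟩
    have hgf : ∀ j, g j ∉ Set.range f := fun j ⟨i, hi⟩ => hfg i j hi
    have hzy : ∀ q, q ∉ Set.range g → z q = y q := fun q hq => by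
      by_cases hqf : q ∈ Set.range f
      · simp only [hz, if_pos hqf]
      · simp only [hz, if_neg hqf, h q hqf hq]
    rw [Finset.sum_eq_single z]
    · rw [embedOp_of_agree f A hxz, embedOp_of_agree g B hzy]
      simp only [hzf, ← hxz _ (hgf _)]
    · intro w _ hw
      by_cases hxw : ∀ q, q ∉ Set.range f → x q = w q
      · rw [embedOp_of_not_agree g B, mul_zero]
        intro hwy
        apply hw
        ext1 q
        by_cases hqf : q ∈ Set.range f
        · obtain ⟨i, rfl⟩ := hqf
          rw [hzf, hwy _ fun ⟨j, hj⟩ => hfg i j hj.symm]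
        · rw [← hxw q hqf, hxz q hqf]
      · rw [embedOp_of_not_agree f A hxw, zero_mul]
    · simp
  · refine Finset.sum_eq_zero fun z _ => ?_
    by_cases hxz : ∀ q, q ∉ Set.range f → x q = z q
    · rw [embedOp_of_not_agree g B, mul_zero]
      exact fun hzy => h fun q hqf hqg => (hxz q hqf).trans (hzy q hqg)
    · rw [embedOp_of_not_agree f A hxz, zero_mul]

/-- Operators on disjoint sets of qubits commute. -/
theorem commute_embedOp {l : ℕ} (g : Fin l ↪ Q) (hfg : ∀ i j, f i ≠ g j)
    (A : QOp (Fin k)) (B : QOp (Fin l)) : Commute (embedOp f A) (embedOp g B) := by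
  classical
  refine Matrix.ext fun x y => ?_
  rw [embedOp_mul_apply_of_disjoint f g hfg,
    embedOp_mul_apply_of_disjoint g f fun i j => (hfg j i).symm]
  simp only [forall_comm (α := _ ∉ Set.range f), mul_comm]

theorem commute_pauliAt_embedOp {q : Q} (hq : q ∉ Set.range f) (s : Pauli1) (A : QOp (Fin k)) :
    Commute (pauliAt q s) (embedOp f A) := by
  let g : Fin 1 ↪ Q := ⟨fun _ => q, fun _ _ _ => Subsingleton.elim _ _⟩
  have : pauliAt q s = embedOp g (pauliAt 0 s) := by rw [embedOp_pauliAt]; rfl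
  rw [this]
  exact commute_embedOp g f (fun _ j h => hq ⟨j, h.symm⟩) _ _

end Embed

/-! ### The commutant of the Pauli group -/

/-- An operator that commutes with all Pauli `X` and `Z` operators is a scalar. -/
theorem exists_eq_smul_one_of_commute {A : QOp Q}
    (hX : ∀ q, Commute (pauliAt q Pauli1.X) A) (hZ : ∀ q, Commute (pauliAt q Pauli1.Z) A) :
    ∃ z : ℂ, A = z • 1 := by
  -- Commuting with the projectors onto bit values forces a diagonal matrix; commuting with `X` then
  -- makes the diagonal invariant under bit flips, hence constant.
  have hdiag : ∀ x y, x ≠ y → A x y = 0 := by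
    intro x y hxy
    obtain ⟨q, hq⟩ := Function.ne_iff.mp hxy
    have := congrFun (congrFun (commute_bitProj (hZ q) (x q)).eq x) y
    rw [bitProj, Matrix.diagonal_mul, Matrix.mul_diagonal] at this
    simpa [hq.symm] using this
  have hA : A = Matrix.diagonal fun x => A x x := by
    ext x y
    by_cases h : x = y
    · subst h; simp
    · rw [hdiag x y h, Matrix.diagonal_apply_ne _ h]
  have hflip : ∀ x q b, A (Function.update x q b) (Function.update x q b) = A x x := by
    intro x q b
    by_cases hb : b = x q
    · subst hb; simp
    have := congrFun (congrFun (hX q).eq x) (Function.update x q b)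
    rw [hA, Matrix.diagonal_mul, Matrix.mul_diagonal] at this
    have hne : pauliAt q Pauli1.X x (Function.update x q b) = 1 := by
      rw [pauliAt, pauliString, Finset.prod_eq_single q]
      · simp only [Function.update_self]
        revert hb
        generalize x q = b'
        fin_cases b <;> fin_cases b' <;> simp [Pauli1.mat]
      · intro q' _ hq'
        simp [Function.update_of_ne hq', Pauli1.mat_I]
      · simp
    rw [hne] at this
    simpa using this
  have hconst : ∀ (x y : Q → Fin 2) (s : Finset Q),
      A (s.piecewise y x) (s.piecewise y x) = A x x := by
    intro x y s
    induction s using Finset.induction_on with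
    | empty => simp
    | insert q s _ ih => rw [Finset.piecewise_insert, hflip, ih]
  refine ⟨A 0 0, ?_⟩
  rw [hA, Matrix.smul_one_eq_diagonal]
  congr 1
  ext1 x
  simpa using hconst 0 x Finset.univ

theorem commute_pauliAt_of_X_Z {A : QOp Q} {q : Q} (hX : Commute (pauliAt q Pauli1.X) A)
    (hZ : Commute (pauliAt q Pauli1.Z) A) (s : Pauli1) : Commute (pauliAt q s) A := by
  cases s
  · rw [pauliAt_I]; exact Commute.one_left A
  · exact hX
  · rw [pauliAt_Y]; exact (hX.mul_left hZ).smul_left _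
  · exact hZ

end Register

section Register

variable {Q : Type} [Fintype Q] [DecidableEq Q]

/-! ### Clifford operators and Pauli rotations -/

theorem IsClifford.mul_conjTranspose {A : QOp Q} (h : IsClifford A) :
    A * A.conjTranspose = 1 := Matrix.mem_unitaryGroup_iff.mp h.1

theorem IsClifford.conjTranspose_mul {A : QOp Q} (h : IsClifford A) :
    A.conjTranspose * A = 1 := Matrix.mem_unitaryGroup_iff'.mp h.1

theorem isClifford_one : IsClifford (1 : QOp Q) :=
  ⟨one_mem _, fun P hP => by simpa using hP⟩

theorem IsClifford.mul {A B : QOp Q} (hA : IsClifford A) (hB : IsClifford B) :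
    IsClifford (A * B) := by
  refine ⟨mul_mem hA.1 hB.1, fun P hP => ?_⟩
  rw [Matrix.conjTranspose_mul]
  simpa only [mul_assoc] using hA.2 _ (hB.2 P hP)

theorem isClifford_smul_one {z : ℂ} (hz : z * star z = 1) : IsClifford (z • (1 : QOp Q)) := by
  refine ⟨?_, fun P hP => ?_⟩
  · rw [Matrix.mem_unitaryGroup_iff, Matrix.star_eq_conjTranspose, Matrix.conjTranspose_smul,
      smul_mul_smul_comm, hz]
    simp
  · rw [Matrix.conjTranspose_smul, smul_mul_assoc, smul_mul_smul_comm, hz]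
    simpa using hP

/-- The inverse square root of two. -/
def invSqrtTwo : ℂ := ((Real.sqrt 2 : ℝ) : ℂ)⁻¹

theorem invSqrtTwo_mul_self : invSqrtTwo * invSqrtTwo = 1 / 2 := by
  rw [invSqrtTwo, ← mul_inv, ← Complex.ofReal_mul, Real.mul_self_sqrt (by norm_num)]
  simp

theorem star_invSqrtTwo : star invSqrtTwo = invSqrtTwo := by
  simp [invSqrtTwo]

/-- The Pauli rotation `(1 + A) / √2`; for a Pauli `A` of square `-1` this is `exp (π A / 4)`. -/
def pauliRot (A : QOp Q) : QOp Q := invSqrtTwo • (1 + A)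

theorem pauliRot_mul (A B : QOp Q) :
    pauliRot A * pauliRot B = (1 / 2 : ℂ) • ((1 + A) * (1 + B)) := by
  rw [pauliRot, pauliRot, smul_mul_smul_comm, invSqrtTwo_mul_self]

theorem pauliRot_neg_mul {A : QOp Q} (hA : A * A = -1) : pauliRot (-A) * pauliRot A = 1 := by
  rw [pauliRot_mul]
  have : (1 + -A) * (1 + A) = (2 : ℂ) • (1 : QOp Q) := by
    simp only [mul_add, add_mul, neg_mul, mul_one, one_mul, hA]
    module
  rw [this, smul_smul]
  norm_num

theorem pauliRot_sq {A : QOp Q} (hA : A * A = -1) : pauliRot A * pauliRot A = A := by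
  rw [pauliRot_mul]
  have : (1 + A) * (1 + A) = (2 : ℂ) • A := by
    simp only [mul_add, add_mul, mul_one, one_mul, hA]
    module
  rw [this, smul_smul]
  norm_num

theorem commute_pauliRot {A X : QOp Q} (h : Commute A X) : Commute (pauliRot A) X :=
  ((Commute.one_left X).add_left h).smul_left _

theorem mul_pauliRot {A A' X : QOp Q} (h : X * A = A' * X) :
    X * pauliRot A = pauliRot A' * X := by
  rw [pauliRot, pauliRot, mul_smul_comm, smul_mul_assoc, mul_add, add_mul, mul_one, one_mul, h]

/-- A rotation conjugates an anticommuting operator to its product with the generator. -/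
theorem pauliRot_mul_of_anticommute {A X : QOp Q} (hA : A * A = -1) (h : A * X = -(X * A)) :
    pauliRot A * X = (A * X) * pauliRot A := by
  simp only [pauliRot, smul_mul_assoc, mul_smul_comm, add_mul, mul_add, one_mul, mul_one]
  congr 1
  rw [h, neg_mul, mul_assoc, hA]
  simp [add_comm]

theorem IsPauli.conjTranspose_of_sq {A : QOp Q} (h : IsPauli A) (hA : A * A = -1) :
    A.conjTranspose = -A := by
  have := h.mul_conjTranspose
  calc A.conjTranspose = -(A * A) * A.conjTranspose := by rw [hA]; simp
    _ = -A := by rw [neg_mul, mul_assoc, this, mul_one]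

/-- Conjugation by the rotation fixes every Pauli that commutes with `A` and multiplies by `A` every
Pauli that anticommutes with it. -/
theorem IsPauli.isClifford_pauliRot {A : QOp Q} (h : IsPauli A) (hA : A * A = -1) :
    IsClifford (pauliRot A) := by
  have hstar : (pauliRot A).conjTranspose = pauliRot (-A) := by
    rw [pauliRot, Matrix.conjTranspose_smul, star_invSqrtTwo, Matrix.conjTranspose_add,
      Matrix.conjTranspose_one, h.conjTranspose_of_sq hA, pauliRot]
  have hinv : pauliRot A * pauliRot (-A) = 1 := by
    simpa using pauliRot_neg_mul (A := -A) (by simpa using hA)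
  refine ⟨?_, fun P hP => ?_⟩
  · rw [Matrix.mem_unitaryGroup_iff, Matrix.star_eq_conjTranspose, hstar, hinv]
  · rw [hstar]
    rcases h.comm hP with hc | hc
    · rw [(commute_pauliRot hc).eq, mul_assoc, hinv, mul_one]
      exact hP
    · rw [pauliRot_mul_of_anticommute hA hc, mul_assoc, hinv, mul_one]
      exact h.mul hP

theorem embedOp_sq_eq_neg_one {k : ℕ} (f : Fin k ↪ Q) {A : QOp (Fin k)} (hA : A * A = -1) :
    embedOp f A * embedOp f A = -1 := by
  rw [← embedOp_mul, hA, embedOp_neg, embedOp_one]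

theorem embedOp_pauliRot {k : ℕ} (f : Fin k ↪ Q) (A : QOp (Fin k)) :
    embedOp f (pauliRot A) = pauliRot (embedOp f A) := by
  rw [pauliRot, embedOp_smul, embedOp_add, embedOp_one, pauliRot]

theorem embedOp_injective {k : ℕ} (f : Fin k ↪ Q) :
    Function.Injective (embedOp f : QOp (Fin k) → QOp Q) := by
  intro A B h
  ext x y
  have := congrFun (congrFun h (Function.extend f x 0)) (Function.extend f y 0)
  have hag : ∀ q, q ∉ Set.range f →
      Function.extend f x (0 : Q → Fin 2) q = Function.extend f y 0 q := fun q hq => by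
    rw [Function.extend_apply' _ _ _ hq, Function.extend_apply' _ _ _ hq]
  simpa [embedOp_of_agree f _ hag, f.injective.extend_apply] using this

/-- A set of at most two qubits of a nonempty register is covered by one or two qubits. -/
theorem exists_embedding_of_card_le_two [Nonempty Q] {B : Finset Q} (hB : B.card ≤ 2) :
    ∃ (k : ℕ) (f : Fin k ↪ Q), 1 ≤ k ∧ k ≤ 2 ∧ ∀ q ∈ B, q ∈ Set.range f := by
  obtain ⟨B', hBB', hne, hB'⟩ : ∃ B', B ⊆ B' ∧ B'.Nonempty ∧ B'.card ≤ 2 := by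
    rcases B.eq_empty_or_nonempty with rfl | h
    · exact ⟨{Classical.arbitrary Q}, by simp, by simp, by simp⟩
    · exact ⟨B, subset_rfl, h, hB⟩
  refine ⟨B'.card, B'.equivFin.symm.toEmbedding.trans (Function.Embedding.subtype _),
    hne.card_pos, hB', fun q hq => ⟨B'.equivFin ⟨q, hBB' hq⟩, by simp⟩⟩

theorem IsPauliOn.isOneTwoQubitClifford_pauliRot [Nonempty Q] {B : Finset Q} {A : QOp Q}
    (h : IsPauliOn B A) (hA : A * A = -1) (hB : B.card ≤ 2) :
    IsOneTwoQubitClifford (pauliRot A) := by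
  obtain ⟨l, p, rfl, hp⟩ := h
  obtain ⟨k, f, hk1, hk2, hf⟩ := exists_embedding_of_card_le_two hB
  have hpf : pauliString p = embedOp f (pauliString fun j => p (f j)) :=
    pauliString_eq_embedOp f fun q hq => hp q fun hqB => hq (hf q hqB)
  have heq : Complex.I ^ l • pauliString p =
      embedOp f (Complex.I ^ l • pauliString fun j => p (f j)) := by
    rw [embedOp_smul, hpf]
  refine ⟨k, f, pauliRot (Complex.I ^ l • pauliString fun j => p (f j)), hk1, hk2, ?_, ?_⟩
  · refine IsPauli.isClifford_pauliRot ⟨l, _, rfl⟩ (embedOp_injective f ?_)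
    rw [embedOp_mul, ← heq, hA, embedOp_neg, embedOp_one]
  · rw [embedOp_pauliRot, heq]

/-- A global phase is counted as a gate on an arbitrary qubit, which is why the register must be
nonempty. -/
theorem isOneTwoQubitClifford_smul_one [Nonempty Q] {z : ℂ} (hz : z * star z = 1) :
    IsOneTwoQubitClifford (z • (1 : QOp Q)) := by
  obtain ⟨k, f, hk1, hk2, -⟩ := exists_embedding_of_card_le_two (B := (∅ : Finset Q)) (by simp)
  exact ⟨k, f, z • 1, hk1, hk2, isClifford_smul_one hz, by rw [embedOp_smul, embedOp_one]⟩

/-! ### Gate counts -/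

/-- `A` is a product of at most `n` one- and two-qubit Clifford gates. -/
def HasCost (A : QOp Q) (n : ℕ) : Prop :=
  ∃ L : List (QOp Q), (∀ B ∈ L, IsOneTwoQubitClifford B ∧ IsClifford B) ∧ evolve L = A ∧
    L.length ≤ n

theorem evolve_nil : evolve ([] : List (QOp Q)) = 1 := rfl

theorem evolve_cons (A : QOp Q) (L : List (QOp Q)) : evolve (A :: L) = evolve L * A := by
  simp [evolve]

theorem evolve_append (L L' : List (QOp Q)) : evolve (L ++ L') = evolve L' * evolve L := by
  simp [evolve]

theorem isClifford_evolve {L : List (QOp Q)} (h : ∀ B ∈ L, IsClifford B) :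
    IsClifford (evolve L) := by
  induction L with
  | nil => exact isClifford_one
  | cons A L ih =>
    rw [evolve_cons]
    exact (ih fun B hB => h B (List.mem_cons_of_mem _ hB)).mul (h A List.mem_cons_self)

theorem hasCost_one : HasCost (1 : QOp Q) 0 := ⟨[], by simp, rfl, le_rfl⟩

theorem HasCost.mono {A : QOp Q} {n n' : ℕ} (h : HasCost A n) (hn : n ≤ n') : HasCost A n' := by
  obtain ⟨L, h1, h2, h3⟩ := h
  exact ⟨L, h1, h2, h3.trans hn⟩

theorem HasCost.mul {A B : QOp Q} {n m : ℕ} (hA : HasCost A n) (hB : HasCost B m) :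
    HasCost (A * B) (n + m) := by
  obtain ⟨L, h1, rfl, h3⟩ := hA
  obtain ⟨L', h1', rfl, h3'⟩ := hB
  refine ⟨L' ++ L, fun C hC => ?_, evolve_append _ _, ?_⟩
  · rcases List.mem_append.mp hC with h | h
    · exact h1' C h
    · exact h1 C h
  · rw [List.length_append]
    omega

theorem HasCost.pow {A : QOp Q} {n : ℕ} (hA : HasCost A n) (k : ℕ) : HasCost (A ^ k) (k * n) := by
  induction k with
  | zero => simpa using hasCost_one
  | succ k ih =>
    rw [pow_succ, Nat.succ_mul]
    exact ih.mul hA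

theorem hasCost_list_prod {L : List (QOp Q)} {n : ℕ} (h : ∀ A ∈ L, HasCost A n) :
    HasCost L.prod (L.length * n) := by
  induction L with
  | nil => simpa using hasCost_one
  | cons A L ih =>
    rw [List.prod_cons, List.length_cons, Nat.succ_mul, add_comm]
    exact (h A List.mem_cons_self).mul (ih fun B hB => h B (List.mem_cons_of_mem _ hB))

/-- Cliffordness on the whole register is recorded next to the gate property, so that products are
Clifford by `isClifford_evolve` without a proof that `embedOp` preserves Cliffords. -/
theorem hasCost_of_gate {A : QOp Q} (h : IsOneTwoQubitClifford A) (h' : IsClifford A) :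
    HasCost A 1 :=
  ⟨[A], by simp [h, h'], by simp [evolve], by simp⟩

variable [Nonempty Q]

theorem hasCost_smul_one {z : ℂ} (hz : z * star z = 1) : HasCost (z • (1 : QOp Q)) 1 :=
  hasCost_of_gate (isOneTwoQubitClifford_smul_one hz) (isClifford_smul_one hz)

theorem HasCost.smul {A : QOp Q} {n : ℕ} (h : HasCost A n) {z : ℂ} (hz : z * star z = 1) :
    HasCost (z • A) (n + 1) := by
  rw [add_comm]
  simpa using (hasCost_smul_one hz).mul h

/-- A Pauli rotation of weight `w` takes at most `2 * w + 1` gates. -/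
theorem IsPauliOn.hasCost_pauliRot {B : Finset Q} {A : QOp Q} (h : IsPauliOn B A)
    (hA : A * A = -1) : HasCost (pauliRot A) (2 * B.card + 1) := by
  induction hn : B.card generalizing B A with
  | zero =>
    exact hasCost_of_gate (h.isOneTwoQubitClifford_pauliRot hA (by omega))
      (h.isPauli.isClifford_pauliRot hA)
  | succ n ih =>
    by_cases hn1 : n ≤ 1
    · exact (hasCost_of_gate (h.isOneTwoQubitClifford_pauliRot hA (by omega))
        (h.isPauli.isClifford_pauliRot hA)).mono (by omega)
    obtain ⟨k, p, rfl, hp⟩ := h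
    by_cases htriv : ∃ q ∈ B, p q = Pauli1.I
    · obtain ⟨q, hq, hpq⟩ := htriv
      refine (ih (B := B.erase q) ⟨k, p, rfl, fun q' hq' => ?_⟩ hA ?_).mono (by omega)
      · by_cases hqq : q' = q
        · rw [hqq, hpq]
        · exact hp q' fun h => hq' (Finset.mem_erase.mpr ⟨hqq, h⟩)
      · rw [Finset.card_erase_of_mem hq, hn]
        rfl
    push Not at htriv
    obtain ⟨q₁, h₁, q₂, h₂, h₁₂⟩ := Finset.one_lt_card.mp (show 1 < B.card by omega)
    obtain ⟨s, hs⟩ := Pauli1.exists_sgn_neg (htriv q₁ h₁)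
    -- `M` anticommutes with `A` because of its factor at `q₁`, and multiplying by it clears the
    -- qubit `q₂`. The factor `I` in `R` makes the square `-1`.
    set M : QOp Q := pauliAt q₁ s * pauliAt q₂ (p q₂) with hM
    set A := Complex.I ^ k • pauliString p with hAdef
    have hMM : M * M = 1 := by
      rw [hM, mul_assoc, ← mul_assoc (pauliAt q₂ _), ← (pauliAt_commute h₁₂ _ _).eq,
        mul_assoc, pauliAt_sq, mul_one, pauliAt_sq]
    have hMA : M * A = -(A * M) := by
      rw [hM, hAdef, mul_smul_comm, mul_assoc, pauliAt_mul_pauliString, Pauli1.sgn_self,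
        smul_mul_assoc, Int.cast_one, one_smul, ← mul_assoc, pauliAt_mul_pauliString, hs,
        smul_mul_assoc, mul_assoc]
      simp
    have hMpauli : IsPauliOn {q₁, q₂} M :=
      ((isPauliOn_pauliAt q₁ s).mono (by simp)).mul ((isPauliOn_pauliAt q₂ _).mono (by simp))
    set R := Complex.I • M with hR
    have hRR : R * R = -1 := by
      rw [hR, smul_mul_smul_comm, Complex.I_mul_I, hMM, neg_one_smul]
    have hRA : R * A = -(A * R) := by
      rw [hR, smul_mul_assoc, hMA, mul_smul_comm, smul_neg]
    have hcard : ({q₁, q₂} : Finset Q).card ≤ 2 := Finset.card_le_two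
    have hRcost : HasCost (pauliRot R) 1 :=
      hasCost_of_gate (hMpauli.I_smul.isOneTwoQubitClifford_pauliRot hRR hcard)
        (hMpauli.I_smul.isPauli.isClifford_pauliRot hRR)
    have hRRn : -R * -R = -1 := by rw [neg_mul_neg, hRR]
    have hRcost' : HasCost (pauliRot (-R)) 1 :=
      hasCost_of_gate (hMpauli.I_smul.neg.isOneTwoQubitClifford_pauliRot hRRn hcard)
        (hMpauli.I_smul.neg.isPauli.isClifford_pauliRot hRRn)
    have hRApauli : IsPauliOn (B.erase q₂) (R * A) := by
      have e1 : IsPauliOn (B.erase q₂) (pauliAt q₁ s) :=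
        (isPauliOn_pauliAt q₁ s).mono (by simp [h₁₂, h₁])
      obtain ⟨l, hl⟩ := pauliString_mul (Function.update (fun _ => Pauli1.I) q₂ (p q₂)) p
      have e2 : IsPauliOn (B.erase q₂) (pauliAt q₂ (p q₂) * pauliString p) := by
        refine ⟨l, _, hl, fun q hq => ?_⟩
        by_cases hqq : q = q₂
        · subst hqq
          simp
        · rw [Function.update_of_ne hqq, Pauli1.I_mul]
          exact hp q fun h => hq (Finset.mem_erase.mpr ⟨hqq, h⟩)
      have : R * A = Complex.I • (pauliAt q₁ s *
          (Complex.I ^ k • (pauliAt q₂ (p q₂) * pauliString p))) := by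
        rw [hR, hM, hAdef, smul_mul_assoc, mul_smul_comm, mul_smul_comm, mul_assoc]
      rw [this]
      exact (e1.mul (e2.smul k)).I_smul
    have hRAsq : R * A * (R * A) = -1 := by
      rw [mul_assoc, ← mul_assoc A, ← neg_eq_iff_eq_neg.mpr hRA]
      simp only [neg_mul, mul_neg, mul_assoc, hA]
      simp [hRR]
    -- The two-qubit rotation about `R` conjugates `A` to `R * A`, whose support is smaller by one.
    -- Each removed qubit thus costs two gates.
    have hkey : pauliRot A = pauliRot (-R) * pauliRot (R * A) * pauliRot R := by
      have : pauliRot (R * A) * pauliRot R = pauliRot R * pauliRot A :=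
        (mul_pauliRot (pauliRot_mul_of_anticommute hRR hRA)).symm
      rw [mul_assoc, this, ← mul_assoc, pauliRot_neg_mul hRR, one_mul]
    rw [hkey]
    have := (hRcost'.mul (ih hRApauli hRAsq (by
      rw [Finset.card_erase_of_mem h₂, hn]; rfl))).mul hRcost
    exact this.mono (by omega)

end Register

/-! ### Gate counts of Paulis, phases and controlled Paulis -/

section Register

variable {Q : Type} [Fintype Q] [DecidableEq Q]

/-- A quarter turn applied twice is the Pauli itself up to phase, so the cost of rotations also
bounds that of Paulis. -/
theorem pauliString_eq_smul_pauliRot_sq (p : Q → Pauli1) :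
    pauliString p = (-Complex.I) •
      (pauliRot (Complex.I • pauliString p) * pauliRot (Complex.I • pauliString p)) := by
  rw [pauliRot_sq, smul_smul]
  · simp
  · rw [smul_mul_smul_comm, pauliString_sq, Complex.I_mul_I, neg_one_smul]

theorem I_pow_mul_star (k : ℕ) : Complex.I ^ k * star (Complex.I ^ k) = 1 := by
  rw [star_pow, ← mul_pow]
  simp

theorem I_smul_sq {A : QOp Q} (hA : A * A = 1) :
    (Complex.I • A) * (Complex.I • A) = -1 := by
  rw [smul_mul_smul_comm, hA, Complex.I_mul_I, neg_one_smul]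

theorem neg_I_smul_sq {A : QOp Q} (hA : A * A = 1) :
    (-Complex.I • A) * (-Complex.I • A) = -1 := by
  rw [smul_mul_smul_comm, hA, neg_mul_neg, Complex.I_mul_I, neg_one_smul]

theorem IsPauliOn.hasCost [Nonempty Q] {B : Finset Q} {A : QOp Q} (h : IsPauliOn B A) :
    HasCost A (4 * B.card + 3) := by
  obtain ⟨k, p, rfl, hp⟩ := h
  have hrot := IsPauliOn.hasCost_pauliRot (B := B) (A := Complex.I • pauliString p)
    ⟨1, p, by simp, hp⟩ (I_smul_sq (pauliString_sq p))
  rw [pauliString_eq_smul_pauliRot_sq, smul_smul]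
  refine ((hrot.mul hrot).smul ?_).mono (by omega)
  have := I_pow_mul_star k
  rw [star_mul, mul_assoc, ← mul_assoc (-Complex.I)]
  simpa using this

theorem hasCost_pauliAt (q : Q) (s : Pauli1) : HasCost (pauliAt q s) 7 := by
  have : Nonempty Q := ⟨q⟩
  simpa using (isPauliOn_pauliAt q s).hasCost

/-- A controlled involution as a product of three rotations. -/
theorem ctrl_eq_smul_pauliRot {a : Q} {P : QOp Q} (hP : P * P = 1)
    (hZP : Commute (pauliAt a Pauli1.Z) P) :
    ctrl a P = ((1 + Complex.I) * invSqrtTwo) •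
      (pauliRot (-Complex.I • pauliAt a Pauli1.Z) *
        (pauliRot (-Complex.I • P) * pauliRot (Complex.I • (pauliAt a Pauli1.Z * P)))) := by
  set Z : QOp Q := pauliAt a Pauli1.Z with hZ
  have hZZ : Z * Z = 1 := pauliAt_sq _ _
  have h1 : P * (Z * P) = Z := by rw [← mul_assoc, ← hZP.eq, mul_assoc, hP, mul_one]
  have h2 : Z * (Z * P) = P := by rw [← mul_assoc, hZZ, one_mul]
  have hc : (1 + Complex.I) * invSqrtTwo * invSqrtTwo * (1 / 2) = (1 + Complex.I) / 4 := by
    rw [mul_assoc (1 + Complex.I), invSqrtTwo_mul_self]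
    ring
  rw [pauliRot_mul, pauliRot, smul_mul_assoc, mul_smul_comm, smul_smul, smul_smul, hc]
  rw [ctrl, bitProj_zero_eq, bitProj_one_eq, ← hZ]
  simp only [add_mul, mul_add, one_mul, mul_one, smul_mul_assoc, mul_smul_comm, h1, h2,
    hZZ, sub_mul]
  match_scalars <;> ring_nf <;>
    simp only [Complex.I_sq, Complex.I_pow_three, Complex.I_pow_four] <;> ring

theorem one_add_I_mul_invSqrtTwo :
    ((1 + Complex.I) * invSqrtTwo) * star ((1 + Complex.I) * invSqrtTwo) = 1 := by
  rw [star_mul, star_invSqrtTwo, mul_assoc, ← mul_assoc invSqrtTwo, invSqrtTwo_mul_self]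
  simp only [star_add, star_one, Complex.star_def, Complex.conj_I]
  linear_combination (-1 / 2 : ℂ) * Complex.I_sq

/-- A controlled `I` is a `Z` rotation up to phase, of cost `3 + 1`; the exponent can be reduced
modulo four, leaving at most three copies. -/
theorem hasCost_ctrl_phase (a : Q) (k : ℕ) :
    HasCost (ctrl a (Complex.I ^ k • (1 : QOp Q))) 12 := by
  have : Nonempty Q := ⟨a⟩
  have h1 : ctrl a (Complex.I • (1 : QOp Q)) =
      ((1 + Complex.I) * invSqrtTwo) • pauliRot (-Complex.I • pauliAt a Pauli1.Z) := by
    rw [pauliRot, smul_smul, mul_assoc, invSqrtTwo_mul_self, ctrl, bitProj_zero_eq,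
      bitProj_one_eq]
    simp only [mul_smul_comm, mul_one, smul_smul]
    match_scalars <;> ring_nf
    simp only [Complex.I_sq]
    ring
  have hpow : ∀ l : ℕ, ctrl a (Complex.I ^ l • (1 : QOp Q)) =
      ctrl a (Complex.I • (1 : QOp Q)) ^ l := by
    intro l
    induction l with
    | zero => simp [ctrl_one]
    | succ l ih =>
      rw [pow_succ (ctrl a _), ← ih, ← ctrl_mul ((Commute.one_right _).smul_right _),
        smul_mul_smul_comm, pow_succ, one_mul]
  have hcost : HasCost (ctrl a (Complex.I • (1 : QOp Q))) 4 := by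
    rw [h1]
    exact ((isPauliOn_pauliAt a Pauli1.Z).neg_I_smul.hasCost_pauliRot
      (neg_I_smul_sq (pauliAt_sq _ _))).smul one_add_I_mul_invSqrtTwo
  have hmod : Complex.I ^ k = Complex.I ^ (k % 4) := by
    conv_lhs => rw [← Nat.div_add_mod k 4, pow_add, pow_mul, Complex.I_pow_four, one_pow, one_mul]
  rw [hmod, hpow]
  have := Nat.mod_lt k (show 4 > 0 by norm_num)
  exact (hcost.pow (k % 4)).mono (by omega)

theorem pauliAt_commute_pauliString {a : Q} {p : Q → Pauli1} (h : p a = Pauli1.I) (s : Pauli1) :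
    Commute (pauliAt a s) (pauliString p) := by
  have := pauliAt_mul_pauliString a s p
  rw [h, Pauli1.sgn_I_right, Int.cast_one, one_smul] at this
  exact this

theorem IsPauliOn.commute_pauliAt {B : Finset Q} {A : QOp Q} (h : IsPauliOn B A) {q : Q}
    (hq : q ∉ B) (s : Pauli1) : Commute (pauliAt q s) A := by
  obtain ⟨k, p, rfl, hp⟩ := h
  exact (pauliAt_commute_pauliString (hp q hq) s).smul_right _

/-- A controlled Pauli of weight `w` takes at most `4 * w + 20` gates. -/
theorem IsPauliOn.hasCost_ctrl {B : Finset Q} {A : QOp Q} (h : IsPauliOn B A) {a : Q}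
    (ha : a ∉ B) : HasCost (ctrl a A) (4 * B.card + 20) := by
  have : Nonempty Q := ⟨a⟩
  obtain ⟨k, p, rfl, hp⟩ := h
  have hcomm : Commute (pauliAt a Pauli1.Z) (pauliString p) :=
    pauliAt_commute_pauliString (hp a ha) _
  have hpB : IsPauliOn B (pauliString p) := ⟨0, p, by simp, hp⟩
  have hZ := isPauliOn_pauliAt a Pauli1.Z
  have hZp : IsPauliOn (insert a B) (pauliAt a Pauli1.Z * pauliString p) :=
    (hZ.mono (by simp)).mul (hpB.mono (by simp))
  have hsq : pauliAt a Pauli1.Z * pauliString p * (pauliAt a Pauli1.Z * pauliString p) = 1 := by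
    rw [mul_assoc, ← mul_assoc (pauliString p), ← hcomm.eq, mul_assoc, pauliString_sq, mul_one,
      pauliAt_sq]
  have h1 : Complex.I ^ k • pauliString p = (Complex.I ^ k • 1) * pauliString p := by simp
  rw [h1, ctrl_mul ((Commute.one_right _).smul_right _),
    ctrl_eq_smul_pauliRot (pauliString_sq p) hcomm]
  have c1 := hZ.neg_I_smul.hasCost_pauliRot (neg_I_smul_sq (pauliAt_sq _ _))
  have c2 := hpB.neg_I_smul.hasCost_pauliRot (neg_I_smul_sq (pauliString_sq p))
  have c3 := hZp.I_smul.hasCost_pauliRot (I_smul_sq hsq)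
  have := (hasCost_ctrl_phase a k).mul ((c1.mul (c2.mul c3)).smul one_add_I_mul_invSqrtTwo)
  refine this.mono ?_
  rw [Finset.card_insert_of_notMem ha, Finset.card_singleton]
  omega

theorem hasCost_ctrl_pauliAt {a q : Q} (s : Pauli1) (h : a ≠ q) :
    HasCost (ctrl a (pauliAt q s)) 24 := by
  simpa using (isPauliOn_pauliAt q s).hasCost_ctrl (a := a) (by simpa using h)

theorem hasCost_ctrl_pauliZ (a b : Q) : HasCost (ctrl a (pauliAt b Pauli1.Z)) 24 := by
  by_cases h : a = b
  · subst h
    rw [ctrl_pauliZ_self]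
    exact (hasCost_pauliAt _ _).mono (by omega)
  · exact hasCost_ctrl_pauliAt _ h

/-! ### Generation of the Clifford group by Pauli rotations -/

theorem eq_zero_of_eq_neg {A : QOp Q} (h : A = -A) : A = 0 := by
  ext x y
  exact self_eq_neg.mp (congrFun (congrFun h x) y)

/-- Commutation up to sign. -/
def SignCommute (A B : QOp Q) : Prop := A * B = B * A ∨ A * B = -(B * A)

/-- `A` is a rotation about a Pauli of square `-1`. -/
def IsPauliRot (A : QOp Q) : Prop := ∃ P, IsPauli P ∧ P * P = -1 ∧ A = pauliRot P

theorem IsPauliRot.isClifford {A : QOp Q} (h : IsPauliRot A) : IsClifford A := by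
  obtain ⟨P, hP, hPP, rfl⟩ := h
  exact hP.isClifford_pauliRot hPP

theorem IsClifford.conj_mul {U : QOp Q} (h : IsClifford U) (A : QOp Q) :
    U * A * U.conjTranspose * U = U * A := by
  rw [mul_assoc, h.conjTranspose_mul, mul_one]

theorem IsClifford.conj_sq {U A : QOp Q} (h : IsClifford U) (hA : A * A = 1) :
    U * A * U.conjTranspose * (U * A * U.conjTranspose) = 1 := by
  rw [← mul_assoc, ← mul_assoc, h.conj_mul, mul_assoc U, hA, mul_one, h.mul_conjTranspose]

/-- Conjugation by `U` preserves commutation with an operator that `U` preserves up to sign. -/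
theorem SignCommute.commute_conj {U A B : QOp Q} (hU : IsClifford U) (h : SignCommute A U)
    (hAB : Commute A B) : Commute A (U * B * U.conjTranspose) := by
  have key : A * (U * B * U.conjTranspose) * U = U * B * U.conjTranspose * A * U := by
    rw [mul_assoc A, hU.conj_mul, mul_assoc _ A]
    rcases h with h | h
    · rw [h, ← mul_assoc A, h, ← mul_assoc, hU.conj_mul, mul_assoc, hAB.eq, mul_assoc]
    · rw [h, ← mul_assoc A, h, mul_neg, ← mul_assoc, hU.conj_mul, neg_mul, mul_assoc, hAB.eq,
        mul_assoc]
  have := congrArg (· * U.conjTranspose) key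
  simpa only [Commute, SemiconjBy, mul_assoc, hU.mul_conjTranspose, mul_one] using this

/-- The sign from moving `A` past `U` occurs twice, once for `U` and once for its adjoint, and
cancels. -/
theorem SignCommute.anticommute_conj {U A B : QOp Q} (hU : IsClifford U) (h : SignCommute A U)
    (hAB : A * B = -(B * A)) :
    A * (U * B * U.conjTranspose) = -(U * B * U.conjTranspose * A) := by
  have key : A * (U * B * U.conjTranspose) * U = -(U * B * U.conjTranspose * A) * U := by
    rw [mul_assoc A, hU.conj_mul, neg_mul, mul_assoc _ A]
    rcases h with h | h
    · rw [h, ← mul_assoc A, h, ← mul_assoc, hU.conj_mul, mul_assoc, hAB, mul_neg, mul_assoc]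
    · rw [h, ← mul_assoc A, h, mul_neg, ← mul_assoc, hU.conj_mul, neg_mul, mul_assoc, hAB,
        mul_neg, mul_assoc]
  have := congrArg (· * U.conjTranspose) key
  simpa only [neg_mul, mul_assoc, hU.mul_conjTranspose, mul_one] using this

/-- One rotation moves the image `P` of `A` to an anticommuting Pauli `M`. -/
theorem exists_pauliRot_mul {U A P M : QOp Q} (hU : U * A = P * U) (hP : IsPauli P)
    (hM : IsPauli M) (hPP : P * P = 1) (hMM : M * M = 1) (hPM : P * M = -(M * P)) :
    IsPauliRot (pauliRot (P * M)) ∧ pauliRot (P * M) * U * A = -M * (pauliRot (P * M) * U) := by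
  have e1 : P * M * P = -M := by rw [hPM, neg_mul, mul_assoc, hPP, mul_one]
  have hsq : P * M * (P * M) = -1 := by rw [← mul_assoc, e1, neg_mul, hMM]
  refine ⟨⟨_, hP.mul hM, hsq, rfl⟩, ?_⟩
  have := pauliRot_mul_of_anticommute hsq (X := P) (by rw [e1, ← mul_assoc, hPP, one_mul])
  rw [mul_assoc, hU, ← mul_assoc, this, e1, mul_assoc]

theorem Pauli1.exists_sgn_neg_X {s : Pauli1} (h : s ≠ Pauli1.I) :
    ∃ t, sgn t Pauli1.X = -1 ∧ sgn t s = -1 := by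
  cases s
  · exact absurd rfl h
  · exact ⟨Pauli1.Z, by simp [sgn], by simp [sgn]⟩
  · exact ⟨Pauli1.Z, by simp [sgn], by simp [sgn]⟩
  · exact ⟨Pauli1.Y, by simp [sgn], by simp [sgn]⟩

theorem pauliAt_anticommute {q : Q} {s : Pauli1} {p : Q → Pauli1} (h : s.sgn (p q) = -1)
    (c : ℂ) : c • pauliString p * pauliAt q s = -(pauliAt q s * c • pauliString p) := by
  rw [mul_smul_comm, pauliAt_mul_pauliString, h]
  simp

/-- A Pauli that is not a scalar and `X` on the qubit `q₀` have a common anticommuting Pauli,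
which can be chosen to act trivially where the given Pauli does. -/
theorem exists_anticommute {S : Finset Q} {q₀ : Q} (hq₀ : q₀ ∉ S) {P W : QOp Q} (hP : IsPauli P)
    (hWP : IsPauli W) (hW : P * W = -(W * P)) (hPS : ∀ q ∈ S, ∀ s, Commute (pauliAt q s) P) :
    ∃ M, IsPauli M ∧ M * M = 1 ∧ P * M = -(M * P) ∧
      M * pauliAt q₀ Pauli1.X = -(pauliAt q₀ Pauli1.X * M) ∧
      ∀ q ∈ S, ∀ s, Commute (pauliAt q s) M := by
  have hP' := hP
  obtain ⟨k, p, hPk⟩ := hP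
  have htriv : ∀ q ∈ S, p q = Pauli1.I := by
    intro q hq
    by_contra hne
    obtain ⟨t, ht⟩ := Pauli1.exists_sgn_neg hne
    have h1 := pauliAt_anticommute ht (Complex.I ^ k)
    rw [← hPk, (hPS q hq t).eq] at h1
    exact (hP'.mul (isPauli_pauliAt q t)).ne_zero (eq_zero_of_eq_neg h1)
  -- If `P` is trivial at `q₀`, `Z` there handles `X`, and a Pauli at some other qubit handles `P`;
  -- such a qubit exists because `W` shows that `P` is not scalar. Otherwise one Pauli at `q₀`
  -- anticommutes with both.
  by_cases h0 : p q₀ = Pauli1.I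
  · obtain ⟨q₂, hq₂⟩ : ∃ q, p q ≠ Pauli1.I := by
      by_contra hall
      push Not at hall
      have hp1 : P = Complex.I ^ k • 1 := by
        rw [hPk, funext hall, pauliString_I]
      refine (hP'.mul hWP).ne_zero (eq_zero_of_eq_neg ?_)
      conv_rhs => rw [hp1, smul_mul_assoc, one_mul, ← mul_one W, ← mul_smul_comm, ← hp1]
      exact hW
    have h02 : q₀ ≠ q₂ := fun h => hq₂ (h ▸ h0)
    obtain ⟨t, ht⟩ := Pauli1.exists_sgn_neg hq₂
    have hc := pauliAt_commute h02 Pauli1.Z t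
    refine ⟨pauliAt q₀ Pauli1.Z * pauliAt q₂ t, (isPauli_pauliAt _ _).mul (isPauli_pauliAt _ _),
      ?_, ?_, ?_, fun q hq s => Commute.mul_right ?_ ?_⟩
    · rw [mul_assoc, ← mul_assoc (pauliAt q₂ t), ← hc.eq, mul_assoc, pauliAt_sq, mul_one,
        pauliAt_sq]
    · have h1 : Commute (pauliAt q₀ Pauli1.Z) P := by
        rw [hPk]
        exact (pauliAt_commute_pauliString h0 _).smul_right _
      have h2 : P * pauliAt q₂ t = -(pauliAt q₂ t * P) := by
        rw [hPk]
        exact pauliAt_anticommute ht _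
      rw [← mul_assoc, ← h1.eq, mul_assoc, h2, mul_neg, mul_assoc]
    · rw [mul_assoc, ← (pauliAt_commute h02 Pauli1.X t).eq, ← mul_assoc, pauliAt_comm]
      simp [Pauli1.sgn, mul_assoc]
    · refine pauliAt_commute ?_ _ _
      rintro rfl
      exact hq₀ hq
    · refine pauliAt_commute ?_ _ _
      rintro rfl
      exact hq₂ (htriv _ hq)
  · obtain ⟨t, htX, ht⟩ := Pauli1.exists_sgn_neg_X h0
    refine ⟨pauliAt q₀ t, isPauli_pauliAt _ _, pauliAt_sq _ _, ?_, ?_, fun q hq s => ?_⟩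
    · rw [hPk]
      exact pauliAt_anticommute ht _
    · rw [pauliAt_comm, htX]
      simp
    · refine pauliAt_commute ?_ _ _
      rintro rfl
      exact hq₀ hq

theorem SignCommute.mul_right {A B C : QOp Q} (hB : SignCommute A B) (hC : SignCommute A C) :
    SignCommute A (B * C) := by
  unfold SignCommute at *
  rw [← mul_assoc, mul_assoc B C A]
  rcases hB with hB | hB <;> rcases hC with hC | hC <;> rw [hB] <;>
    simp [mul_assoc, hC]

theorem Commute.signCommute {A B : QOp Q} (h : Commute A B) : SignCommute A B := Or.inl h

theorem pauliAt_X_mul_Z (q : Q) : pauliAt q Pauli1.X * pauliAt q Pauli1.Z =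
    -(pauliAt q Pauli1.Z * pauliAt q Pauli1.X) := by
  rw [pauliAt_comm]
  simp [Pauli1.sgn]

/-- Two rotations move the image of `X` on the qubit `q₀` back to `X`. -/
theorem exists_rots_X {S : Finset Q} {q₀ : Q} (hq₀ : q₀ ∉ S) {U : QOp Q} (hU : IsClifford U)
    (hS : ∀ q ∈ S, SignCommute (pauliAt q Pauli1.X) U ∧ SignCommute (pauliAt q Pauli1.Z) U) :
    ∃ R R', IsPauliRot R ∧ IsPauliRot R' ∧ SignCommute (pauliAt q₀ Pauli1.X) (R * R' * U) ∧
      ∀ q ∈ S, ∀ s, Commute (pauliAt q s) (R * R') := by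
  set X : QOp Q := pauliAt q₀ Pauli1.X with hX
  set P := U * X * U.conjTranspose with hP
  set W := U * pauliAt q₀ Pauli1.Z * U.conjTranspose with hW
  have hPpauli : IsPauli P := hU.2 _ (isPauli_pauliAt _ _)
  have hWpauli : IsPauli W := hU.2 _ (isPauli_pauliAt _ _)
  have hPP : P * P = 1 := hU.conj_sq (pauliAt_sq _ _)
  have hXX : X * X = 1 := pauliAt_sq _ _
  have hXpauli : IsPauli X := isPauli_pauliAt _ _
  have hPW : P * W = -(W * P) := by
    rw [hP, hW, ← mul_assoc, ← mul_assoc, hU.conj_mul, mul_assoc U, pauliAt_X_mul_Z, ← mul_assoc,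
      ← mul_assoc, hU.conj_mul]
    simp [mul_assoc, hX]
  have hne : ∀ q ∈ S, q ≠ q₀ := fun q hq h => hq₀ (h ▸ hq)
  have hPS : ∀ q ∈ S, ∀ s, Commute (pauliAt q s) P := fun q hq =>
    commute_pauliAt_of_X_Z ((hS q hq).1.commute_conj hU (pauliAt_commute (hne q hq) _ _))
      ((hS q hq).2.commute_conj hU (pauliAt_commute (hne q hq) _ _))
  -- `P` may commute with `X`, so the route goes through `M`, which anticommutes with both: the
  -- rotation about `P * M` sends `P` to `-M`, and that about `-M * X` sends `-M` to `-X`.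
  obtain ⟨M, hM, hMM, hPM, hMX, hMS⟩ := exists_anticommute hq₀ hPpauli hWpauli hPW hPS
  have hUX : U * X = P * U := (hU.conj_mul X).symm
  obtain ⟨hR, hRU⟩ := exists_pauliRot_mul hUX hPpauli hM hPP hMM hPM
  obtain ⟨hR', hRU'⟩ := exists_pauliRot_mul hRU hM.isPauliOn.neg.isPauli hXpauli
    (by simpa using hMM) hXX (by rw [neg_mul, hMX, mul_neg])
  refine ⟨_, _, hR', hR, Or.inr ?_, fun q hq s => Commute.mul_right ?_ ?_⟩
  · rw [mul_assoc, hRU', neg_mul X, neg_neg]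
  · exact (commute_pauliRot (((hMS q hq s).neg_right.mul_right
      (pauliAt_commute (hne q hq) s _)).symm)).symm
  · exact (commute_pauliRot ((hPS q hq s).mul_right (hMS q hq s)).symm).symm

/-- Two rotations that commute with `X` on the qubit `q₀` move the image of `Z` back to `Z`. -/
theorem exists_rots_Z {S : Finset Q} {q₀ : Q} (hq₀ : q₀ ∉ S) {U : QOp Q} (hU : IsClifford U)
    (hX : SignCommute (pauliAt q₀ Pauli1.X) U)
    (hS : ∀ q ∈ S, SignCommute (pauliAt q Pauli1.X) U ∧ SignCommute (pauliAt q Pauli1.Z) U) :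
    ∃ L : List (QOp Q), (∀ R ∈ L, IsPauliRot R) ∧ L.length ≤ 2 ∧
      SignCommute (pauliAt q₀ Pauli1.Z) (L.prod * U) ∧
      Commute (pauliAt q₀ Pauli1.X) L.prod ∧
      ∀ q ∈ S, ∀ s, Commute (pauliAt q s) L.prod := by
  set X : QOp Q := pauliAt q₀ Pauli1.X with hXdef
  set Z : QOp Q := pauliAt q₀ Pauli1.Z with hZdef
  set P := U * Z * U.conjTranspose with hP
  have hPpauli : IsPauli P := hU.2 _ (isPauli_pauliAt _ _)
  have hZpauli : IsPauli Z := isPauli_pauliAt _ _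
  have hPP : P * P = 1 := hU.conj_sq (pauliAt_sq _ _)
  have hZZ : Z * Z = 1 := pauliAt_sq _ _
  have hXZ : X * Z = -(Z * X) := pauliAt_X_mul_Z q₀
  have hUZ : U * Z = P * U := (hU.conj_mul Z).symm
  have hXP : X * P = -(P * X) := hX.anticommute_conj hU hXZ
  have hne : ∀ q ∈ S, q ≠ q₀ := fun q hq h => hq₀ (h ▸ hq)
  have hPS : ∀ q ∈ S, ∀ s, Commute (pauliAt q s) P := fun q hq =>
    commute_pauliAt_of_X_Z ((hS q hq).1.commute_conj hU (pauliAt_commute (hne q hq) _ _))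
      ((hS q hq).2.commute_conj hU (pauliAt_commute (hne q hq) _ _))
  have hanti : ∀ {A B : QOp Q}, X * A = -(A * X) → X * B = -(B * X) → Commute X (A * B) := by
    intro A B hA hB
    unfold Commute SemiconjBy
    rw [← mul_assoc, hA, neg_mul, mul_assoc, hB, mul_neg, neg_neg, mul_assoc]
  -- If `P` anticommutes with `Z`, one rotation about `P * Z` suffices. Otherwise `Y` is the
  -- intermediate stop: `P` anticommutes with `X` and commutes with `Z`, hence anticommutes with
  -- `Y`. Each generator is a product of two operators that anticommute with `X`, so `X` is not
  -- disturbed.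
  rcases hPpauli.comm hZpauli with hPZ | hPZ
  · set M : QOp Q := pauliAt q₀ Pauli1.Y with hM
    have hMpauli : IsPauli M := isPauli_pauliAt _ _
    have hMM : M * M = 1 := pauliAt_sq _ _
    have hPM : P * M = -(M * P) := by
      rw [hM, pauliAt_Y, ← hXdef, ← hZdef, mul_smul_comm, smul_mul_assoc, ← mul_assoc,
        mul_assoc X, ← hPZ, ← mul_assoc, hXP]
      simp
    have hMZ : M * Z = -(Z * M) := by
      rw [hM, hZdef, pauliAt_comm]; simp [Pauli1.sgn]
    have hXM : X * M = -(M * X) := by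
      rw [hM, hXdef, pauliAt_comm]; simp [Pauli1.sgn]
    obtain ⟨hR, hRU⟩ := exists_pauliRot_mul hUZ hPpauli hMpauli hPP hMM hPM
    obtain ⟨hR', hRU'⟩ := exists_pauliRot_mul hRU hMpauli.isPauliOn.neg.isPauli hZpauli
      (by simpa using hMM) hZZ (by rw [neg_mul, hMZ, mul_neg])
    refine ⟨[pauliRot (-M * Z), pauliRot (P * M)],
      by simpa only [List.forall_mem_cons] using ⟨hR', hR, by simp⟩,
      by simp, Or.inr ?_, ?_,
      fun q hq s => ?_⟩
    · simp only [List.prod_cons, List.prod_nil, mul_one]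
      rw [mul_assoc (pauliRot _), hRU', neg_mul Z, neg_neg]
    · simp only [List.prod_cons, List.prod_nil, mul_one]
      refine Commute.mul_right (commute_pauliRot ?_).symm (commute_pauliRot ?_).symm
      · rw [neg_mul]
        exact (hanti hXM hXZ).symm.neg_left
      · exact (hanti hXP hXM).symm
    · simp only [List.prod_cons, List.prod_nil, mul_one]
      have hqM : Commute (pauliAt q s) M := pauliAt_commute (hne q hq) s _
      refine Commute.mul_right (commute_pauliRot ?_).symm (commute_pauliRot ?_).symm
      · exact (hqM.neg_right.mul_right (pauliAt_commute (hne q hq) s _)).symm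
      · exact ((hPS q hq s).mul_right hqM).symm
  · obtain ⟨hR, hRU⟩ := exists_pauliRot_mul hUZ hPpauli hZpauli hPP hZZ hPZ
    refine ⟨[pauliRot (P * Z)], by simp [hR], by simp, Or.inr ?_, ?_, fun q hq s => ?_⟩
    · simp only [List.prod_singleton]
      rw [hRU, neg_mul, neg_neg]
    · rw [List.prod_singleton]
      exact (commute_pauliRot (hanti hXP hXZ).symm).symm
    · rw [List.prod_singleton]
      exact (commute_pauliRot
        ((hPS q hq s).mul_right (pauliAt_commute (hne q hq) s _)).symm).symm

theorem isClifford_list_prod {L : List (QOp Q)} (h : ∀ R ∈ L, IsPauliRot R) :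
    IsClifford L.prod := by
  induction L with
  | nil => exact isClifford_one
  | cons A L ih =>
    rw [List.prod_cons]
    exact (h A List.mem_cons_self).isClifford.mul (ih fun B hB => h B (List.mem_cons_of_mem _ hB))

/-- Four rotations per qubit turn a Clifford into one that preserves all `X` and `Z`
up to sign. -/
theorem IsClifford.exists_rots {U : QOp Q} (hU : IsClifford U) (S : Finset Q) :
    ∃ L : List (QOp Q), (∀ R ∈ L, IsPauliRot R) ∧ L.length ≤ 4 * S.card ∧
      ∀ q ∈ S, SignCommute (pauliAt q Pauli1.X) (L.prod * U) ∧
        SignCommute (pauliAt q Pauli1.Z) (L.prod * U) := by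
  induction S using Finset.induction_on with
  | empty => exact ⟨[], by simp, by simp, by simp⟩
  | insert q₀ S hq₀ ih =>
    obtain ⟨L, hL, hlen, hS⟩ := ih
    obtain ⟨R, R', hR, hR', hX, hRS⟩ := exists_rots_X hq₀ ((isClifford_list_prod hL).mul hU) hS
    set U₁ := R * R' * (L.prod * U) with hU₁
    have hU₁c : IsClifford U₁ :=
      (hR.isClifford.mul hR'.isClifford).mul ((isClifford_list_prod hL).mul hU)
    have hS₁ : ∀ q ∈ S, SignCommute (pauliAt q Pauli1.X) U₁ ∧ SignCommute (pauliAt q Pauli1.Z) U₁ :=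
      fun q hq => ⟨(hRS q hq _).signCommute.mul_right (hS q hq).1,
        (hRS q hq _).signCommute.mul_right (hS q hq).2⟩
    obtain ⟨L', hL', hlen', hZ, hX', hS'⟩ := exists_rots_Z hq₀ hU₁c hX hS₁
    refine ⟨L' ++ R :: R' :: L, ?_, ?_, ?_⟩
    · intro A hA
      simp only [List.mem_append, List.mem_cons] at hA
      rcases hA with h | rfl | rfl | h
      exacts [hL' A h, hR, hR', hL A h]
    · rw [Finset.card_insert_of_notMem hq₀]
      simp only [List.length_append, List.length_cons]
      omega
    · have hprod : (L' ++ R :: R' :: L).prod * U = L'.prod * U₁ := by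
        simp [hU₁, mul_assoc]
      rw [hprod]
      intro q hq
      rcases Finset.mem_insert.mp hq with rfl | hq
      · exact ⟨hX'.signCommute.mul_right hX, hZ⟩
      · exact ⟨(hS' q hq _).signCommute.mul_right (hS₁ q hq).1,
          (hS' q hq _).signCommute.mul_right (hS₁ q hq).2⟩

/-- The inverse of a rotation about `P` is the rotation about `-P`, so inverting a product keeps its
length. -/
theorem exists_inv_rots {L : List (QOp Q)} (hL : ∀ R ∈ L, IsPauliRot R) :
    ∃ L' : List (QOp Q), (∀ R ∈ L', IsPauliRot R) ∧ L'.length = L.length ∧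
      L'.prod * L.prod = 1 := by
  induction L with
  | nil => exact ⟨[], by simp, rfl, by simp⟩
  | cons A L ih =>
    obtain ⟨L', h1, h2, h3⟩ := ih fun B hB => hL B (List.mem_cons_of_mem _ hB)
    obtain ⟨P, hP, hPP, rfl⟩ := hL A List.mem_cons_self
    refine ⟨L' ++ [pauliRot (-P)], ?_, by simp [h2], ?_⟩
    · intro B hB
      rcases List.mem_append.mp hB with h | h
      · exact h1 B h
      · rw [List.mem_singleton] at h
        exact ⟨-P, hP.isPauliOn.neg.isPauli, by simpa using hPP, h⟩
    · rw [List.prod_append, List.prod_singleton, List.prod_cons, mul_assoc, ← mul_assoc _ _ L.prod,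
        pauliRot_neg_mul hPP, one_mul, h3]

/-- A unitary that preserves all `X` and `Z` up to sign is a Pauli string up to phase. -/
theorem IsClifford.eq_smul_pauliString {U : QOp Q} (hU : IsClifford U)
    (h : ∀ q, SignCommute (pauliAt q Pauli1.X) U ∧ SignCommute (pauliAt q Pauli1.Z) U) :
    ∃ (z : ℂ) (p : Q → Pauli1), z * star z = 1 ∧ U = z • pauliString p := by
  have hlabel : ∀ q, ∃ t : Pauli1,
      pauliAt q Pauli1.X * U = (Pauli1.X.sgn t : ℂ) • (U * pauliAt q Pauli1.X) ∧
      pauliAt q Pauli1.Z * U = (Pauli1.Z.sgn t : ℂ) • (U * pauliAt q Pauli1.Z) := by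
    intro q
    obtain ⟨hX | hX, hZ | hZ⟩ := h q
    · exact ⟨Pauli1.I, by simp [hX], by simp [hZ]⟩
    · exact ⟨Pauli1.X, by simp [hX], by simp [hZ, Pauli1.sgn]⟩
    · exact ⟨Pauli1.Z, by simp [hX, Pauli1.sgn], by simp [hZ]⟩
    · exact ⟨Pauli1.Y, by simp [hX, Pauli1.sgn], by simp [hZ, Pauli1.sgn]⟩
  -- `p` is the Pauli string with the same commutation signs as `U`; `pauliString p * U` then
  -- commutes with every `X` and `Z` and is a scalar.
  choose p hp using hlabel
  have hsgn : ∀ s t : Pauli1, (s.sgn t : ℂ) * s.sgn t = 1 := by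
    intro s t
    rcases Pauli1.sgn_eq s t with h | h <;> simp [h]
  have hcomm : ∀ q s, pauliAt q s * U = (s.sgn (p q) : ℂ) • (U * pauliAt q s) →
      Commute (pauliAt q s) (pauliString p * U) := by
    intro q s h
    unfold Commute SemiconjBy
    rw [← mul_assoc, pauliAt_mul_pauliString, smul_mul_assoc, mul_assoc, h, mul_smul_comm,
      smul_smul, hsgn, one_smul, mul_assoc]
  obtain ⟨z, hz⟩ := exists_eq_smul_one_of_commute (fun q => hcomm q _ (hp q).1)
    fun q => hcomm q _ (hp q).2
  have hUz : U = z • pauliString p := by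
    have := congrArg (pauliString p * ·) hz
    simpa [← mul_assoc, pauliString_sq] using this
  refine ⟨z, p, ?_, hUz⟩
  have := hU.mul_conjTranspose
  rw [hUz, Matrix.conjTranspose_smul, smul_mul_smul_comm, pauliString_conjTranspose,
    pauliString_sq] at this
  simpa using congrFun (congrFun this 0) 0

/-- Every Clifford is, up to phase, a product of `4 * |Q| + 2` Pauli rotations. -/
theorem IsClifford.eq_smul_prod {U : QOp Q} (hU : IsClifford U) :
    ∃ (z : ℂ) (L : List (QOp Q)), z * star z = 1 ∧ (∀ R ∈ L, IsPauliRot R) ∧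
      L.length ≤ 4 * Fintype.card Q + 2 ∧ U = z • L.prod := by
  obtain ⟨L, hL, hlen, hLU⟩ := hU.exists_rots Finset.univ
  obtain ⟨L', hL', hlen', hinv⟩ := exists_inv_rots hL
  obtain ⟨z, p, hz, hzp⟩ := ((isClifford_list_prod hL).mul hU).eq_smul_pauliString
    fun q => hLU q (Finset.mem_univ q)
  have hR : IsPauliRot (pauliRot (Complex.I • pauliString p)) :=
    ⟨_, ⟨1, p, by simp⟩, I_smul_sq (pauliString_sq p), rfl⟩
  set R := pauliRot (Complex.I • pauliString p) with hRdef
  refine ⟨z * -Complex.I, L' ++ [R, R], ?_, ?_, ?_, ?_⟩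
  · rw [star_mul]
    linear_combination (z * star z) * (by simp : -Complex.I * star (-Complex.I) = 1) + hz
  · intro A hA
    rcases List.mem_append.mp hA with h | h
    · exact hL' A h
    · have : A = R := by simpa using h
      rwa [this]
  · rw [Finset.card_univ] at hlen
    simp only [List.length_append, List.length_cons, List.length_nil]
    omega
  · calc U = L'.prod * (L.prod * U) := by rw [← mul_assoc, hinv, one_mul]
      _ = z • (L'.prod * pauliString p) := by rw [hzp, mul_smul_comm]
      _ = _ := by
        rw [pauliString_eq_smul_pauliRot_sq, mul_smul_comm, smul_smul, List.prod_append]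
        simp [hRdef]

/-- The number of gates that suffices for a Clifford on `k` qubits. -/
def cliffordCost (k : ℕ) : ℕ := (4 * k + 2) * (2 * k + 1) + 1

theorem IsClifford.hasCost_embedOp [Nonempty Q] {k : ℕ} (f : Fin k ↪ Q) {V : QOp (Fin k)}
    (hV : IsClifford V) : HasCost (embedOp f V) (cliffordCost k) := by
  obtain ⟨z, L, hz, hL, hlen, rfl⟩ := hV.eq_smul_prod
  have hprod : ∀ L : List (QOp (Fin k)), embedOp f L.prod = (L.map (embedOp f)).prod := by
    intro L
    induction L with
    | nil => simp [embedOp_one]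
    | cons A L ih => rw [List.prod_cons, embedOp_mul, ih, List.map_cons, List.prod_cons]
  rw [embedOp_smul, hprod]
  refine HasCost.smul ?_ hz
  refine (hasCost_list_prod (n := 2 * k + 1) ?_).mono ?_
  · intro A hA
    obtain ⟨R, hR, rfl⟩ := List.mem_map.mp hA
    obtain ⟨P, hP, hPP, rfl⟩ := hL R hR
    rw [embedOp_pauliRot]
    simpa using (hP.embedOp f).hasCost_pauliRot (embedOp_sq_eq_neg_one f hPP)
  · rw [List.length_map]
    simp only [Fintype.card_fin] at hlen
    gcongr

end Register

section Register

variable {Q : Type} [Fintype Q] [DecidableEq Q]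

/-! ### Propagation of an error through the gates that act on one block of data qubits -/

/-- The commutation factor of the target becomes a controlled factor, since on the branch with
control zero nothing has to be exchanged. This form, with the factor in front, serves the tail `D`;
`ctrl_mul_of_eq_right` serves the head `W`. -/
theorem ctrl_mul_of_eq_left {a : Q} {A X R : QOp Q} (hX : Commute (pauliAt a Pauli1.Z) X)
    (hR : Commute (pauliAt a Pauli1.Z) R) (h : A * X = R * (X * A)) :
    ctrl a A * X = ctrl a R * (X * ctrl a A) := by
  have e : ctrl a (R * (X * A)) = ctrl a R * ctrl a (X * A) := ctrl_mul hR _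
  have hX0 := (commute_bitProj hX 0).eq
  have hX1 := (commute_bitProj hX 1).eq
  have h1 : X * ctrl a A = bitProj a 0 * X + bitProj a 1 * (X * A) := by
    rw [ctrl, mul_add, ← mul_assoc X, ← hX0, ← hX1, mul_assoc]
  have hR0 := (commute_bitProj hR 0).eq
  have hR1 := (commute_bitProj hR 1).eq
  have h2 : ctrl a R * bitProj a 0 = bitProj a 0 := by
    rw [ctrl, add_mul, bitProj_mul_self, mul_assoc, ← hR0, ← mul_assoc, bitProj_one_mul_zero,
      zero_mul, add_zero]
  have h3 : ctrl a R * bitProj a 1 = bitProj a 1 * R := by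
    rw [ctrl, add_mul, bitProj_zero_mul_one, mul_assoc, ← hR1, ← mul_assoc, bitProj_mul_self,
      zero_add]
  rw [h1, mul_add, ← mul_assoc, h2, ← mul_assoc, h3, ctrl, add_mul, mul_assoc, h, mul_assoc]

theorem mul_ctrl_of_eq {a : Q} {X A A' : QOp Q} (hX : Commute (pauliAt a Pauli1.Z) X)
    (h : X * A = A' * X) : X * ctrl a A = ctrl a A' * X := by
  rw [ctrl, ctrl, mul_add, add_mul, ← (commute_bitProj hX 0).eq, ← mul_assoc,
    ← (commute_bitProj hX 1).eq, mul_assoc, h, mul_assoc]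

theorem ctrl_mul_of_eq_right {a : Q} {A X R : QOp Q} (hX : Commute (pauliAt a Pauli1.Z) X)
    (hR : Commute (pauliAt a Pauli1.Z) R) (h : A * X = X * (R * A)) :
    ctrl a A * X = X * (ctrl a R * ctrl a A) := by
  rw [← ctrl_mul hR, mul_ctrl_of_eq hX h.symm]

/-- The product of the Pauli `Z` operators on a list of qubits. -/
def zString (S : List Q) : QOp Q := (S.map fun a => pauliAt a Pauli1.Z).prod

theorem hasCost_ctrl_zString (b : Q) (S : List Q) :
    HasCost (ctrl b (zString S)) (S.length * 24) := by
  induction S with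
  | nil => simpa [zString, ctrl_one] using hasCost_one
  | cons a S ih =>
    rw [zString, List.map_cons, List.prod_cons, ctrl_mul, List.length_cons, Nat.succ_mul, add_comm]
    · exact (hasCost_ctrl_pauliZ b a).mul ih
    · by_cases h : b = a
      · subst h; exact Commute.refl _
      · exact pauliAt_commute h _ _

/-- A block of data qubits, given algebraically: the operators `outer` that the gates outside the
block are built from, the ancillas, the operator `V` that is measured on the block, and the Pauli
operators on the block that are measured by the stabilizer rounds. -/
structure QubitBlock (Q : Type) [Fintype Q] [DecidableEq Q] where
  outer : Set (QOp Q)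
  anc : Set Q
  V : QOp Q
  paulis : Set (QOp Q)
  Z_mem : ∀ a ∈ anc, pauliAt a Pauli1.Z ∈ outer
  Z_commute : ∀ a ∈ anc, ∀ g ∈ outer, Commute g (pauliAt a Pauli1.Z)
  V_commute : ∀ g ∈ outer, Commute g V
  pauli_commute : ∀ P ∈ paulis, ∀ g ∈ outer, Commute g P
  pauli_sq : ∀ P ∈ paulis, P * P = 1

namespace QubitBlock

variable (β : QubitBlock Q)

/-- An operator that commutes with everything outside the block. -/
def IsLocal (X : QOp Q) : Prop := ∀ g ∈ β.outer, Commute g X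

/-- An operator on the ancillas that is central among the local operators. -/
def IsPhase (φ : QOp Q) : Prop := β.IsLocal φ ∧ ∀ X, β.IsLocal X → Commute φ X

/-- A local operator that commutes up to sign with `V` and with the Paulis of the block. -/
def IsGood (R : QOp Q) : Prop :=
  β.IsLocal R ∧ SignCommute β.V R ∧ ∀ P ∈ β.paulis, SignCommute P R

/-- A local operator that commutes with the Paulis of the block up to a phase, and with `V` up to
the Pauli `Z` operators on the ancillas `S`. -/
def IsTail (D : QOp Q) (S : List Q) : Prop :=
  β.IsLocal D ∧ (∀ P ∈ β.paulis, ∃ φ, β.IsPhase φ ∧ P * D = φ * (D * P)) ∧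
    β.V * D = zString S * (D * β.V) ∧ ∀ a ∈ S, a ∈ β.anc

/-- An operator whose commutators with the gates of the block are good, where `κ` bounds the cost
of the operator that the controlled `V` gates create. -/
def IsHead (W : QOp Q) (κ : ℕ) : Prop :=
  β.IsLocal W ∧ (∀ P ∈ β.paulis, ∃ R, β.IsGood R ∧ P * W = W * (R * P)) ∧
    ∃ R R', β.IsGood R ∧ β.V * W = W * (R * β.V) ∧ W * R = R' * W ∧
      ∀ b ∈ β.anc, HasCost (ctrl b R') κ

/-- A sequence of gates of which `s` are controlled Paulis on the block, `t` are controlled `V`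
gates, and all others commute with the local operators. -/
inductive Circuit : List (QOp Q) → ℕ → ℕ → Prop
  | nil : Circuit [] 0 0
  | idle {G : QOp Q} {L : List (QOp Q)} {s t : ℕ} (hG : ∀ X, β.IsLocal X → Commute G X)
      (hL : Circuit L s t) : Circuit (G :: L) s t
  | pauli {a : Q} {P : QOp Q} {L : List (QOp Q)} {s t : ℕ} (ha : a ∈ β.anc) (hP : P ∈ β.paulis)
      (hc : HasCost (ctrl a P) 24) (hL : Circuit L s t) : Circuit (ctrl a P :: L) (s + 1) t
  | block {a : Q} {L : List (QOp Q)} {s t : ℕ} (ha : a ∈ β.anc) (hL : Circuit L s t) :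
      Circuit (ctrl a β.V :: L) s (t + 1)

variable {β}

theorem IsLocal.mul {X Y : QOp Q} (hX : β.IsLocal X) (hY : β.IsLocal Y) : β.IsLocal (X * Y) :=
  fun g hg => (hX g hg).mul_right (hY g hg)

theorem isLocal_one : β.IsLocal 1 := fun _ _ => Commute.one_right _

theorem isPhase_one : β.IsPhase 1 := ⟨isLocal_one, fun _ _ => Commute.one_left _⟩

theorem isPhase_Z {a : Q} (ha : a ∈ β.anc) : β.IsPhase (pauliAt a Pauli1.Z) :=
  ⟨β.Z_commute a ha, fun _ hX => hX _ (β.Z_mem a ha)⟩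

theorem IsPhase.mul {φ ψ : QOp Q} (hφ : β.IsPhase φ) (hψ : β.IsPhase ψ) : β.IsPhase (φ * ψ) :=
  ⟨hφ.1.mul hψ.1, fun X hX => (hφ.2 X hX).mul_left (hψ.2 X hX)⟩

theorem isPhase_zString {S : List Q} (hS : ∀ a ∈ S, a ∈ β.anc) : β.IsPhase (zString S) := by
  induction S with
  | nil => exact isPhase_one
  | cons a S ih =>
    rw [zString, List.map_cons, List.prod_cons]
    exact (isPhase_Z (hS a List.mem_cons_self)).mul
      (ih fun b hb => hS b (List.mem_cons_of_mem _ hb))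

theorem IsLocal.commute_Z {X : QOp Q} (hX : β.IsLocal X) {a : Q} (ha : a ∈ β.anc) :
    Commute (pauliAt a Pauli1.Z) X := hX _ (β.Z_mem a ha)

theorem IsLocal.ctrl {X : QOp Q} (hX : β.IsLocal X) {a : Q} (ha : a ∈ β.anc) :
    β.IsLocal (ctrl a X) := fun g hg =>
  (commute_ctrl (β.Z_commute a ha g hg).symm (hX g hg).symm).symm

theorem IsPhase.ctrl {φ : QOp Q} (hφ : β.IsPhase φ) {a : Q} (ha : a ∈ β.anc) :
    β.IsPhase (ctrl a φ) :=
  ⟨hφ.1.ctrl ha, fun X hX => commute_ctrl (hX.commute_Z ha) (hφ.2 X hX)⟩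

theorem isLocal_V : β.IsLocal β.V := β.V_commute

theorem isTail_one : β.IsTail 1 [] :=
  ⟨isLocal_one, fun P _ => ⟨1, isPhase_one, by simp⟩, by simp [zString], by simp⟩

theorem IsPhase.isTail {φ : QOp Q} (hφ : β.IsPhase φ) : β.IsTail φ [] := by
  refine ⟨hφ.1, fun P hP => ⟨1, isPhase_one, ?_⟩, ?_, by simp⟩
  · rw [one_mul, (hφ.2 P (β.pauli_commute P hP)).eq]
  · simp [zString, (hφ.2 _ isLocal_V).eq]

/-- Phases are central among the local operators, so those produced by the two factors can be
collected in front. -/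
theorem IsTail.mul {D D' : QOp Q} {S S' : List Q} (h : β.IsTail D S) (h' : β.IsTail D' S') :
    β.IsTail (D * D') (S ++ S') := by
  obtain ⟨h1, h2, h3, h4⟩ := h
  obtain ⟨h1', h2', h3', h4'⟩ := h'
  refine ⟨h1.mul h1', fun P hP => ?_, ?_, ?_⟩
  · obtain ⟨φ, hφ, he⟩ := h2 P hP
    obtain ⟨φ', hφ', he'⟩ := h2' P hP
    refine ⟨φ * φ', hφ.mul hφ', ?_⟩
    rw [← mul_assoc P, he, mul_assoc φ, mul_assoc D, he', ← mul_assoc D, ← (hφ'.2 D h1).eq]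
    simp only [mul_assoc]
  · have hz := (isPhase_zString h4').2 D h1
    rw [← mul_assoc β.V, h3, mul_assoc (zString S), mul_assoc D, h3', ← mul_assoc D, ← hz.eq]
    simp only [zString, List.map_append, List.prod_append, mul_assoc]
  · intro a ha
    rcases List.mem_append.mp ha with h | h
    exacts [h4 a h, h4' a h]

/-- An operator that anticommutes with `R` passes `ctrl a R` at the price of `Z` on `a`, by
`ctrl_neg`; one that commutes passes freely. Hence at most one ancilla enters `S`. -/
theorem IsGood.isTail_ctrl {R : QOp Q} (hR : β.IsGood R) {a : Q} (ha : a ∈ β.anc) :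
    ∃ S : List Q, β.IsTail (ctrl a R) S ∧ S.length ≤ 1 := by
  obtain ⟨h1, h2, h3⟩ := hR
  have key : ∀ {X : QOp Q}, β.IsLocal X → X * R = -(R * X) →
      X * ctrl a R = pauliAt a Pauli1.Z * (ctrl a R * X) := by
    intro X hX h
    rw [← mul_assoc, ← ctrl_neg, mul_ctrl_of_eq (hX.commute_Z ha) (A' := -R) (by rw [h, neg_mul])]
  have hP : ∀ P ∈ β.paulis, ∃ φ, β.IsPhase φ ∧ P * ctrl a R = φ * (ctrl a R * P) := by
    intro P hP
    rcases h3 P hP with h | h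
    · refine ⟨1, isPhase_one, ?_⟩
      rw [one_mul, mul_ctrl_of_eq (β.pauli_commute P hP _ (β.Z_mem a ha)) h]
    · exact ⟨_, isPhase_Z ha, key (β.pauli_commute P hP) h⟩
  rcases h2 with h | h
  · refine ⟨[], ⟨h1.ctrl ha, hP, ?_, by simp⟩, by simp⟩
    rw [mul_ctrl_of_eq (isLocal_V.commute_Z ha) h]
    simp [zString]
  · refine ⟨[a], ⟨h1.ctrl ha, hP, ?_, by simpa using ha⟩, by simp⟩
    rw [key isLocal_V h]
    simp [zString]

/-- The error `W * D` passes a controlled Pauli of the block. -/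
theorem IsHead.mul_ctrl_pauli {W D P : QOp Q} {S : List Q} {κ n : ℕ} {a : Q}
    (hW : β.IsHead W κ) (hD : β.IsTail D S) (ha : a ∈ β.anc) (hP : P ∈ β.paulis)
    (hc : HasCost (ctrl a P) 24) (hn : HasCost (W * D) n) :
    ∃ D' S', β.IsTail D' S' ∧ S'.length ≤ S.length + 1 ∧
      ctrl a P * (W * D) = W * D' * ctrl a P ∧ HasCost (W * D') (n + 48) := by
  obtain ⟨hW1, hW2, -⟩ := hW
  obtain ⟨R, hR, hRW⟩ := hW2 P hP
  obtain ⟨φ, hφ, hφD⟩ := hD.2.1 P hP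
  obtain ⟨S₀, hS₀, hlen⟩ := hR.isTail_ctrl ha
  have e1 := ctrl_mul_of_eq_right (hW1.commute_Z ha) (hR.1.commute_Z ha) hRW
  have e2 := ctrl_mul_of_eq_left (hD.1.commute_Z ha) (hφ.1.commute_Z ha) hφD
  have e3 : ctrl a P * (W * D) = W * (ctrl a R * (ctrl a φ * D)) * ctrl a P := by
    rw [← mul_assoc, e1, mul_assoc, mul_assoc, e2]
    simp only [mul_assoc]
  have hGG : ctrl a P * ctrl a P = 1 := by
    rw [← ctrl_mul ((β.pauli_commute P hP) _ (β.Z_mem a ha)), β.pauli_sq P hP, ctrl_one]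
  refine ⟨_, _, hS₀.mul ((hφ.ctrl ha).isTail.mul hD), ?_, e3, ?_⟩
  · simp only [List.length_append, List.nil_append]
    omega
  -- The gate is its own inverse, so the new error is the old one conjugated by it, at cost `24 +
  -- 24`; no bound on `ctrl a φ` is needed.
  · have e4 : W * (ctrl a R * (ctrl a φ * D)) = ctrl a P * (W * D) * ctrl a P := by
      rw [e3, mul_assoc _ (ctrl a P), hGG, mul_one]
    rw [e4]
    exact ((hc.mul hn).mul hc).mono (by omega)

/-- The error `W * D` passes a controlled `V` gate. -/
theorem IsHead.mul_ctrl_V {W D : QOp Q} {S : List Q} {κ n : ℕ} {a : Q}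
    (hW : β.IsHead W κ) (hD : β.IsTail D S) (ha : a ∈ β.anc) (hn : HasCost (W * D) n) :
    ∃ D' S', β.IsTail D' S' ∧ S'.length ≤ S.length + 1 ∧
      ctrl a β.V * (W * D) = W * D' * ctrl a β.V ∧
      HasCost (W * D') (n + κ + 24 * S.length) := by
  obtain ⟨hW1, -, R, R', hR, hRW, hRR', hcost⟩ := hW
  obtain ⟨S₀, hS₀, hlen⟩ := hR.isTail_ctrl ha
  have hφ := isPhase_zString hD.2.2.2
  have e1 := ctrl_mul_of_eq_right (hW1.commute_Z ha) (hR.1.commute_Z ha) hRW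
  have e2 := ctrl_mul_of_eq_left (hD.1.commute_Z ha) (hφ.1.commute_Z ha) hD.2.2.1
  refine ⟨_, _, hS₀.mul ((hφ.ctrl ha).isTail.mul hD), ?_, ?_, ?_⟩
  · simp only [List.length_append, List.nil_append]
    omega
  · rw [← mul_assoc, e1, mul_assoc, mul_assoc, e2]
    simp only [mul_assoc]
  · have e4 : W * (ctrl a R * (ctrl a (zString S) * D)) =
        ctrl a R' * (ctrl a (zString S) * (W * D)) := by
      rw [← mul_assoc W, mul_ctrl_of_eq (hW1.commute_Z ha) hRR', mul_assoc, ← mul_assoc W,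
        ← ((hφ.ctrl ha).2 W hW1).eq, mul_assoc]
    rw [e4]
    exact ((hcost a ha).mul ((hasCost_ctrl_zString a S).mul hn)).mono (by omega)

/-- Each block gate adds at most one ancilla to the list, so no controlled `V` gate ever meets more
than `S.length + s + t` of them; this yields the product `t * (s + t)` in the bound. -/
theorem IsHead.propagate_tail {W : QOp Q} {κ : ℕ} (hW : β.IsHead W κ) {L : List (QOp Q)} {s t : ℕ}
    (hL : β.Circuit L s t) :
    ∀ {D : QOp Q} {S : List Q} {n : ℕ}, β.IsTail D S → HasCost (W * D) n →
      ∃ E, evolve L * (W * D) = E * evolve L ∧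
        HasCost E (n + 48 * s + t * (κ + 24 * (S.length + s + t))) := by
  induction hL with
  | nil =>
    intro D S n _ hn
    exact ⟨W * D, by simp [evolve_nil], hn.mono (by omega)⟩
  | @idle G L s t hG _ ih =>
    intro D S n hD hn
    obtain ⟨E, hE, hc⟩ := ih hD hn
    refine ⟨E, ?_, hc⟩
    rw [evolve_cons, mul_assoc, (hG _ (hW.1.mul hD.1)).eq, ← mul_assoc, hE, mul_assoc]
  | @pauli a P L s t ha hP hc _ ih =>
    intro D S n hD hn
    obtain ⟨D', S', hD', hlen, he, hn'⟩ := hW.mul_ctrl_pauli hD ha hP hc hn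
    obtain ⟨E, hE, hc⟩ := ih hD' hn'
    refine ⟨E, ?_, hc.mono ?_⟩
    · rw [evolve_cons, mul_assoc, he, ← mul_assoc, hE, mul_assoc]
    · have : t * (κ + 24 * (S'.length + s + t)) ≤ t * (κ + 24 * (S.length + (s + 1) + t)) :=
        Nat.mul_le_mul_left _ (by omega)
      omega
  | @block a L s t ha _ ih =>
    intro D S n hD hn
    obtain ⟨D', S', hD', hlen, he, hn'⟩ := hW.mul_ctrl_V hD ha hn
    obtain ⟨E, hE, hc⟩ := ih hD' hn'
    refine ⟨E, ?_, hc.mono ?_⟩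
    · rw [evolve_cons, mul_assoc, he, ← mul_assoc, hE, mul_assoc]
    · have : t * (κ + 24 * (S'.length + s + t)) ≤ t * (κ + 24 * (S.length + s + (t + 1))) :=
        Nat.mul_le_mul_left _ (by omega)
      have h2 : (t + 1) * (κ + 24 * (S.length + s + (t + 1))) =
        t * (κ + 24 * (S.length + s + (t + 1))) + (κ + 24 * (S.length + s + (t + 1))) := by ring
      omega

/-- The error `W` propagates through the circuit. -/
theorem IsHead.propagate {W : QOp Q} {κ n s t : ℕ} (hW : β.IsHead W κ) {L : List (QOp Q)}
    (hL : β.Circuit L s t) (hn : HasCost W n) :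
    ∃ E, evolve L * W = E * evolve L ∧ HasCost E (n + 48 * s + t * (κ + 24 * (s + t))) := by
  simpa using hW.propagate_tail hL isTail_one (by simpa using hn)

end QubitBlock

end Register

section Register

variable {Q : Type} [Fintype Q] [DecidableEq Q]

/-! ### Commutators of Paulis with a Clifford of scalar square -/

/-- The commutator of a Pauli with a Clifford `V` of scalar square is a Pauli that commutes with
`V` up to sign. -/
theorem IsClifford.exists_commutator {V P : QOp Q} (hV : IsClifford V) {u : ℂ}
    (hVV : V * V = u • 1) (hP : IsPauli P) (hPP : P * P = 1) :
    ∃ R, IsPauli R ∧ P * V = V * (R * P) ∧ V * P = R * (P * V) ∧ SignCommute V R := by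
  -- The scalar square makes `V` proportional to its adjoint.
  have hVu : u • V.conjTranspose = V := by
    calc u • V.conjTranspose = V * V * V.conjTranspose := by rw [hVV]; simp
      _ = V := by rw [mul_assoc, hV.mul_conjTranspose, mul_one]
  have hPstar : P.conjTranspose = P := by
    calc P.conjTranspose = P.conjTranspose * (P * P) := by rw [hPP, mul_one]
      _ = P := by rw [← mul_assoc, hP.conjTranspose_mul, one_mul]
  have hR : IsPauli (V * P * V.conjTranspose * P) := (hV.2 P hP).mul hP
  refine ⟨V * P * V.conjTranspose * P, hR, ?_, ?_, ?_⟩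
  · rw [mul_assoc _ P P, hPP, mul_one, ← mul_assoc, ← mul_assoc, hVV]
    simp only [smul_mul_assoc, one_mul]
    rw [← mul_smul_comm, hVu]
  · rw [← mul_assoc, mul_assoc _ P P, hPP, mul_one, hV.conj_mul]
  · have hstar : (V * P * V.conjTranspose * P).conjTranspose =
        P * V * P * V.conjTranspose := by
      simp only [Matrix.conjTranspose_mul, Matrix.conjTranspose_conjTranspose, hPstar, mul_assoc]
    -- With `R` the commutator, `V R = u P V† P = P V P = R† V`, and the adjoint of a Pauli is plus
    -- or minus itself.
    have key : V * (V * P * V.conjTranspose * P) =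
        (V * P * V.conjTranspose * P).conjTranspose * V := by
      rw [hstar, mul_assoc (P * V * P), hV.conjTranspose_mul, mul_one, ← mul_assoc, ← mul_assoc,
        ← mul_assoc, hVV]
      simp only [smul_mul_assoc, one_mul]
      rw [← smul_mul_assoc, ← mul_smul_comm, hVu]
    unfold SignCommute
    rw [key]
    rcases hR.conjTranspose_eq with h | h <;> rw [h]
    · exact Or.inl rfl
    · exact Or.inr (neg_mul _ _)

/-- Paulis commute with operators on other qubits. -/
theorem IsPauliOn.commute_embedOp {B : Finset Q} {A : QOp Q} (h : IsPauliOn B A) {k : ℕ}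
    (f : Fin k ↪ Q) (hf : ∀ i, f i ∉ B) (V : QOp (Fin k)) : Commute A (embedOp f V) := by
  obtain ⟨l, p, rfl, hp⟩ := h
  let g : Fin B.card ↪ Q := B.equivFin.symm.toEmbedding.trans (Function.Embedding.subtype _)
  have hg : ∀ i, g i ∈ B := fun i => (B.equivFin.symm i).2
  have hgr : ∀ q ∈ B, q ∈ Set.range g := fun q hq => ⟨B.equivFin ⟨q, hq⟩, by simp [g]⟩
  rw [pauliString_eq_embedOp g fun q hq => hp q fun hqB => hq (hgr q hqB)]
  exact (_root_.commute_embedOp g f (fun i j h => hf j (h ▸ hg i)) _ _).smul_left _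

theorem SignCommute.neg {A B : QOp Q} (h : SignCommute A B) : SignCommute A (-B) := by
  unfold SignCommute at *
  rcases h with h | h <;> simp [h]

namespace QubitBlock

variable {β : QubitBlock Q}

theorem IsGood.neg {R : QOp Q} (h : β.IsGood R) : β.IsGood (-R) :=
  ⟨fun g hg => (h.1 g hg).neg_right, h.2.1.neg, fun P hP => (h.2.2 P hP).neg⟩

theorem isGood_one : β.IsGood 1 :=
  ⟨isLocal_one, (Commute.one_right _).signCommute, fun _ _ => (Commute.one_right _).signCommute⟩

/-- The error `V` commutes with the controlled `V` gates, so they create nothing and any `κ` works.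
-/
theorem isHead_V (κ : ℕ) (h : ∀ P ∈ β.paulis, ∃ R, β.IsGood R ∧ P * β.V = β.V * (R * P)) :
    β.IsHead β.V κ :=
  ⟨isLocal_V, h, 1, 1, isGood_one, by simp, by simp, fun b _ => by
    rw [ctrl_one]
    exact hasCost_one.mono (Nat.zero_le _)⟩

/-- To the right of `P` the commutator with `V` appears as `P * R * P = ±R`, which is still good;
moved back to the left of `P` it is `R`, whose controlled version has cost `κ`. -/
theorem isHead_pauli {P R : QOp Q} {κ : ℕ} (hP : P ∈ β.paulis) (hβ : ∀ P ∈ β.paulis, IsPauli P)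
    (hR : β.IsGood R) (hRp : IsPauli R) (hVP : β.V * P = R * (P * β.V))
    (hκ : ∀ b ∈ β.anc, HasCost (ctrl b R) κ) : β.IsHead P κ := by
  have hPP := β.pauli_sq P hP
  refine ⟨β.pauli_commute P hP, fun P' hP' => ?_, P * R * P, R, ?_, ?_, ?_, hκ⟩
  · rcases (hβ P' hP').comm (hβ P hP) with h | h
    · exact ⟨1, isGood_one, by rw [h, one_mul]⟩
    · exact ⟨-1, isGood_one.neg, by rw [h, neg_one_mul, mul_neg]⟩
  · rcases hRp.comm (hβ P hP) with h | h
    · rw [mul_assoc, h, ← mul_assoc, hPP, one_mul]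
      exact hR
    · rw [mul_assoc, h, mul_neg, ← mul_assoc, hPP, one_mul]
      exact hR.neg
  · rw [hVP]
    simp only [← mul_assoc, hPP, one_mul]
  · simp only [← mul_assoc, hPP, one_mul]

end QubitBlock

end Register

/-! ### The factors of a transversal PSC of square one -/

/-- If the Pauli `V_j²` were nontrivial at a qubit, some Pauli `M` there would anticommute with it.
But `M` commutes with all other factors, so it would anticommute with the square of the whole
product, which is one. -/
theorem TransversalPSC.exists_sq_eq {n ℓ : ℕ} (U : TransversalPSC n ℓ) (hU : U.op * U.op = 1)
    (j : Fin ℓ) : ∃ k : ℕ, U.V j * U.V j = Complex.I ^ k • 1 := by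
  obtain ⟨k, p, hp⟩ := (U.psc j).2.2
  refine ⟨k, ?_⟩
  suffices h : ∀ i, p i = Pauli1.I by rw [hp, funext h, pauliString_I]
  intro i
  by_contra hi
  obtain ⟨t, ht⟩ := Pauli1.exists_sgn_neg hi
  have hanti : embedOp (U.place j) (U.V j * U.V j) * pauliAt (U.place j i) t =
      -(pauliAt (U.place j i) t * embedOp (U.place j) (U.V j * U.V j)) := by
    rw [← embedOp_pauliAt, ← embedOp_mul, ← embedOp_mul, ← embedOp_neg, hp,
      pauliAt_anticommute ht]
  obtain ⟨l₁, l₂, hl⟩ := List.append_of_mem (List.mem_finRange j)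
  have hnd := List.nodup_finRange ℓ
  rw [hl] at hnd
  have hne : ∀ j' ∈ l₁ ++ l₂, j' ≠ j := by
    have := (List.nodup_middle.mp hnd)
    rw [List.nodup_cons] at this
    intro j' hj' h
    exact this.1 (h ▸ hj')
  set F : Fin ℓ → QOp (Fin n) := fun i => embedOp (U.place i) (U.V i) with hF
  have hop : U.op = (l₁.map F).prod * (F j * (l₂.map F).prod) := by
    rw [TransversalPSC.op, List.ofFn_eq_map, hl]
    simp [hF]
  have hcomm : ∀ X : QOp (Fin n), (∀ j', j' ≠ j → Commute X (F j')) →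
      ∀ l : List (Fin ℓ), (∀ j' ∈ l, j' ≠ j) → Commute X (l.map F).prod := by
    intro X hX l hl
    refine Commute.list_prod_right _ _ fun Y hY => ?_
    obtain ⟨j', hj', rfl⟩ := List.mem_map.mp hY
    exact hX j' (hl j' hj')
  have h₁ : ∀ j' ∈ l₁, j' ≠ j := fun j' h => hne j' (List.mem_append_left _ h)
  have h₂ : ∀ j' ∈ l₂, j' ≠ j := fun j' h => hne j' (List.mem_append_right _ h)
  have hFc : ∀ j', j' ≠ j → Commute (F j) (F j') := fun j' h =>
    commute_embedOp _ _ (U.disjoint j j' h.symm) _ _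
  have hMc : ∀ j', j' ≠ j → Commute (pauliAt (U.place j i) t) (F j') := by
    intro j' h
    refine commute_pauliAt_embedOp _ ?_ _ _
    rintro ⟨b, hb⟩
    exact U.disjoint j' j h b i hb
  set M := pauliAt (U.place j i) t with hM
  set Y := (l₁.map F).prod * (l₂.map F).prod with hY
  have hFY : Commute (F j) Y := (hcomm _ hFc _ h₁).mul_right (hcomm _ hFc _ h₂)
  have hMY : Commute M Y := (hcomm _ hMc _ h₁).mul_right (hcomm _ hMc _ h₂)
  have hopY : U.op = F j * Y := by
    rw [hop, ← mul_assoc, ← (hcomm _ hFc _ h₁).eq, mul_assoc]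
  have hsq : embedOp (U.place j) (U.V j * U.V j) * (Y * Y) = 1 := by
    rw [embedOp_mul, ← hU, hopY]
    change F j * F j * (Y * Y) = _
    exact hFY.mul_mul_mul_comm _ _
  set N := embedOp (U.place j) (U.V j * U.V j) with hN
  have hMneg : M = -M := by
    calc M = N * (Y * Y) * M := by rw [hsq, one_mul]
      _ = N * M * (Y * Y) := by rw [mul_assoc N, ← (hMY.mul_right hMY).eq, ← mul_assoc N]
      _ = -(M * (N * (Y * Y))) := by rw [hanti, neg_mul, mul_assoc]
      _ = -M := by rw [hsq, mul_one]
  exact (isPauli_pauliAt _ _).ne_zero (eq_zero_of_eq_neg hMneg)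

/-! ### Gate labels and gate counts of a protocol -/

namespace StandardProtocol

variable {n m ℓ r : ℕ} (p : StandardProtocol n m ℓ r)

/-- The gate labels of a protocol: `inl (t, i, q)` is the gate of the check `i` on the data qubit
`q` in the round `t`, and `inr (t, j)` is the gate of the tensor factor `j` in the round `t`. -/
abbrev GateLabel (n m ℓ r : ℕ) : Type := (Fin r × Fin m × Fin n) ⊕ (Fin r × Fin ℓ)

/-- The operator of the tensor factor `j` on the register of the protocol. -/
def factorOp (j : Fin ℓ) : QOp (ProtocolQubit n m r) :=
  embedOp ((p.U.place j).trans Function.Embedding.inl) (p.U.V j)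

/-- The ancilla that controls a gate. -/
def control : GateLabel n m ℓ r → ProtocolQubit n m r
  | .inl (t, i, _) => Sum.inr (t, some i)
  | .inr (t, _) => Sum.inr (t, none)

/-- The operator that a gate controls. -/
def target : GateLabel n m ℓ r → QOp (ProtocolQubit n m r)
  | .inl (_, i, q) => pauliAt (Sum.inl q) (p.check i q)
  | .inr (_, j) => p.factorOp j

/-- The gate with a given label. -/
def gate (g : GateLabel n m ℓ r) : QOp (ProtocolQubit n m r) := ctrl (control g) (p.target g)

/-- The gate labels of a round. -/
def roundLabels (t : Fin r) : List (GateLabel n m ℓ r) :=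
  match p.round t with
  | Round.stab L => L.map fun e => .inl (t, e)
  | Round.psc L => L.map fun j => .inr (t, j)

/-- The gate labels of a protocol, in their order in time. -/
def labels : List (GateLabel n m ℓ r) := (List.finRange r).flatMap p.roundLabels

theorem gates_eq_map_labels : p.gates = p.labels.map p.gate := by
  rw [gates, labels, List.map_flatMap]
  congr 1
  ext1 t
  rw [roundGates, roundLabels]
  cases p.round t <;> simp [gate, control, target, factorOp, Function.comp_def]

/-- A list of labels without repetitions in which all Paulis are nontrivial. -/
def IsProper (l : List (GateLabel n m ℓ r)) : Prop :=
  l.Nodup ∧ ∀ t i q, .inl (t, i, q) ∈ l → p.check i q ≠ Pauli1.I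

/-- Labels carry their round, so repetitions could only occur within a round. All gate counts rest
on the two properties of `IsProper`, which pass to any final segment of the circuit. -/
theorem isProper_labels : p.IsProper p.labels := by
  have hround : ∀ t, ∀ g ∈ p.roundLabels t,
      (∃ e, g = .inl (t, e) ∧ p.check e.1 e.2 ≠ Pauli1.I) ∨ ∃ j, g = .inr (t, j) := by
    intro t g hg
    have hv := p.valid t
    rw [roundLabels] at hg
    cases h : p.round t with
    | stab L =>
      rw [h] at hg hv
      obtain ⟨e, he, rfl⟩ := List.mem_map.mp hg
      obtain ⟨-, T, hT⟩ := hv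
      exact Or.inl ⟨e, rfl, ((hT e.1 e.2).mp he).2⟩
    | psc L =>
      rw [h] at hg
      obtain ⟨j, -, rfl⟩ := List.mem_map.mp hg
      exact Or.inr ⟨j, rfl⟩
  refine ⟨?_, ?_⟩
  · rw [labels, List.nodup_flatMap]
    refine ⟨fun t _ => ?_, (List.nodup_finRange r).imp fun {t t'} htt => ?_⟩
    · have hv := p.valid t
      rw [roundLabels]
      cases h : p.round t with
      | stab L =>
        rw [h] at hv
        exact hv.1.map fun e e' hee => by simpa using hee
      | psc L =>
        rw [h] at hv
        exact hv.1.map fun e e' hee => by simpa using hee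
    · intro g hg hg'
      rcases hround t g hg with ⟨e, rfl, -⟩ | ⟨e, rfl⟩ <;>
        rcases hround t' _ hg' with ⟨e', h, -⟩ | ⟨e', h⟩ <;> simp_all
  · intro t i q h
    obtain ⟨t', -, h'⟩ := List.mem_flatMap.mp h
    rcases hround t' _ h' with ⟨e, he, hc⟩ | ⟨j, hj⟩
    · simp only [Sum.inl.injEq, Prod.mk.injEq] at he
      rw [← he.2] at hc
      exact hc
    · simp at hj

variable {p}

theorem IsProper.of_cons {g : GateLabel n m ℓ r} {l : List (GateLabel n m ℓ r)}
    (h : p.IsProper (g :: l)) : p.IsProper l :=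
  ⟨(List.nodup_cons.mp h.1).2, fun t i q hm => h.2 t i q (List.mem_cons_of_mem _ hm)⟩

theorem IsProper.of_append {l l' : List (GateLabel n m ℓ r)}
    (h : p.IsProper (l ++ l')) : p.IsProper l' :=
  ⟨(List.nodup_append.mp h.1).2.1, fun t i q hm => h.2 t i q (List.mem_append_right _ hm)⟩

/-- Whether a gate is a controlled Pauli on one of the data qubits in `B`. -/
def onQubits (B : Finset (Fin n)) : GateLabel n m ℓ r → Bool
  | .inl (_, _, q) => decide (q ∈ B)
  | .inr _ => false

/-- Whether a gate belongs to one of the tensor factors in `J`. -/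
def onFactors (J : Finset (Fin ℓ)) : GateLabel n m ℓ r → Bool
  | .inl _ => false
  | .inr (_, j) => decide (j ∈ J)

theorem countP_le_card {α : Type*} [DecidableEq α] {l : List α} (hl : l.Nodup) (P : α → Bool)
    (s : Finset α) (hs : ∀ a ∈ l, P a = true → a ∈ s) : l.countP P ≤ s.card := by
  rw [List.countP_eq_length_filter, ← List.toFinset_card_of_nodup (hl.filter P)]
  refine Finset.card_le_card fun a ha => ?_
  rw [List.mem_toFinset, List.mem_filter] at ha
  exact hs a ha.1 ha.2

theorem IsProper.countP_onQubits_le {l : List (GateLabel n m ℓ r)} (h : p.IsProper l)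
    (B : Finset (Fin n)) : l.countP (onQubits B) ≤ r * (B.card * p.wq) := by
  let s : Finset (GateLabel n m ℓ r) := (Finset.univ ×ˢ B.biUnion fun q =>
    (Finset.univ.filter fun i => p.check i q ≠ Pauli1.I).image fun i => (i, q)).map
      Function.Embedding.inl
  refine (countP_le_card h.1 _ s ?_).trans ?_
  · rintro (⟨t, i, q⟩ | ⟨t, j⟩) hg hB
    · have hq : q ∈ B := by simpa [onQubits] using hB
      simp only [s, Finset.mem_map, Finset.mem_product, Finset.mem_univ, true_and,
        Finset.mem_biUnion, Finset.mem_image, Finset.mem_filter, Function.Embedding.inl_apply]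
      exact ⟨(t, i, q), ⟨q, hq, i, h.2 t i q hg, rfl⟩, rfl⟩
    · simp [onQubits] at hB
  · rw [Finset.card_map, Finset.card_product, Finset.card_univ, Fintype.card_fin]
    refine Nat.mul_le_mul_left _ (Finset.card_biUnion_le_card_mul _ _ _ fun q _ => ?_)
    exact Finset.card_image_le.trans
      (Finset.le_sup (f := fun q => (Finset.univ.filter fun i => p.check i q ≠ Pauli1.I).card)
        (Finset.mem_univ q))

theorem IsProper.countP_onFactors_le {l : List (GateLabel n m ℓ r)} (h : p.IsProper l)
    (J : Finset (Fin ℓ)) : l.countP (onFactors J) ≤ r * J.card := by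
  let s : Finset (GateLabel n m ℓ r) := (Finset.univ ×ˢ J).map Function.Embedding.inr
  refine (countP_le_card h.1 _ s ?_).trans ?_
  · rintro (⟨t, i, q⟩ | ⟨t, j⟩) hg hJ
    · simp [onFactors] at hJ
    · have hj : j ∈ J := by simpa [onFactors] using hJ
      simp [s, hj]
  · rw [Finset.card_map, Finset.card_product, Finset.card_univ, Fintype.card_fin]

/-- A PSC ancilla controls at most one gate per factor, a check ancilla at most one per qubit of its
check, and a data qubit none. The sum covers all cases. -/
theorem IsProper.countP_control_le {l : List (GateLabel n m ℓ r)} (h : p.IsProper l)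
    (a : ProtocolQubit n m r) : l.countP (fun g => decide (control g = a)) ≤ p.wc + ℓ := by
  rcases a with q | ⟨t, _ | i⟩
  · rw [List.countP_eq_zero.mpr]
    · exact Nat.zero_le _
    · rintro (⟨t, i, q⟩ | ⟨t, j⟩) - <;> simp [control]
  · let s : Finset (GateLabel n m ℓ r) := Finset.univ.image fun j => .inr (t, j)
    refine (countP_le_card h.1 _ s ?_).trans ?_
    · rintro (⟨t, i, q⟩ | ⟨t, j⟩) - hg
      · simp [control] at hg
      · simp only [control, decide_eq_true_eq, Sum.inr.injEq, Prod.mk.injEq, and_true] at hg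
        simp [s, hg]
    · have : s.card ≤ ℓ := Finset.card_image_le.trans (by simp)
      omega
  · let s : Finset (GateLabel n m ℓ r) :=
      (Finset.univ.filter fun q => p.check i q ≠ Pauli1.I).image fun q => .inl (t, i, q)
    refine (countP_le_card h.1 _ s ?_).trans ?_
    · rintro (⟨t', i', q⟩ | ⟨t', j⟩) hm hg
      · simp only [control, decide_eq_true_eq, Sum.inr.injEq, Prod.mk.injEq,
          Option.some.injEq] at hg
        obtain ⟨rfl, rfl⟩ := hg
        simpa [s] using h.2 _ _ _ hm
      · simp [control] at hg
    · have h1 : s.card ≤ p.wc := Finset.card_image_le.trans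
        (Finset.le_sup (f := fun i => (Finset.univ.filter fun q => p.check i q ≠ Pauli1.I).card)
          (Finset.mem_univ i))
      omega

variable (p)

theorem rS_add_rL : p.rS + p.rL = r := by
  have := Finset.card_filter_add_card_filter_not (s := (Finset.univ : Finset (Fin r)))
    (fun t => (p.round t).isStab = true)
  simpa [rS, rL] using this

/-- Makes `w_c + ℓ` at least one, so that the cost of a single data error fits into the final bound.
-/
theorem wc_pos (h : 0 < p.wq) : 0 < p.wc := by
  rw [wq, Finset.lt_sup_iff] at h
  obtain ⟨q, -, hq⟩ := h
  obtain ⟨i, hi⟩ := Finset.card_pos.mp hq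
  rw [Finset.mem_filter] at hi
  rw [wc, Finset.lt_sup_iff]
  exact ⟨i, Finset.mem_univ i, Finset.card_pos.mpr ⟨q, by simp [hi.2]⟩⟩

end StandardProtocol

/-! ### Blocks of data qubits in a protocol and propagation of data errors -/

namespace StandardProtocol

variable {n m ℓ r : ℕ} (p : StandardProtocol n m ℓ r)

/-- The operators that the gates outside the data qubits `B` and the tensor factors `J` are
built from. -/
def outerOps (B : Finset (Fin n)) (J : Finset (Fin ℓ)) : Set (QOp (ProtocolQubit n m r)) :=
  {X | (∃ a, X = pauliAt (Sum.inr a) Pauli1.Z) ∨ (∃ q ∉ B, ∃ s, X = pauliAt (Sum.inl q) s) ∨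
    ∃ j ∉ J, X = p.factorOp j}

variable {p}

theorem pauliAt_inr_commute_factorOp (a : Fin r × Option (Fin m)) (s : Pauli1) (j : Fin ℓ) :
    Commute (pauliAt (Sum.inr a) s) (p.factorOp j) := by
  refine commute_pauliAt_embedOp _ ?_ _ _
  rintro ⟨i, hi⟩
  simp at hi

theorem factorOp_commute {j j' : Fin ℓ} (h : j ≠ j') :
    Commute (p.factorOp j) (p.factorOp j') :=
  commute_embedOp _ _ (fun a b h' => p.U.disjoint j j' h a b (by simpa using h')) _ _

theorem pauliAt_inl_commute_factorOp {q : Fin n} {j : Fin ℓ} (h : ∀ i, p.U.place j i ≠ q)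
    (s : Pauli1) : Commute (pauliAt (Sum.inl q) s) (p.factorOp j) := by
  refine commute_pauliAt_embedOp _ ?_ _ _
  rintro ⟨i, hi⟩
  exact h i (by simpa using hi)

variable (p)

/-- The block of the data qubits `B`, which meets only the tensor factors in `J`. -/
def qubitBlock (B : Finset (Fin n)) (J : Finset (Fin ℓ)) (V : QOp (ProtocolQubit n m r))
    (hJ : ∀ j ∉ J, ∀ i, p.U.place j i ∉ B) (hV : ∀ g ∈ p.outerOps B J, Commute g V) :
    QubitBlock (ProtocolQubit n m r) where
  outer := p.outerOps B J
  anc := Set.range Sum.inr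
  V := V
  paulis := {X | ∃ q ∈ B, ∃ s, X = pauliAt (Sum.inl q) s}
  Z_mem := by
    rintro _ ⟨a, rfl⟩
    exact Or.inl ⟨a, rfl⟩
  Z_commute := by
    rintro _ ⟨a, rfl⟩ g (⟨b, rfl⟩ | ⟨q, -, s, rfl⟩ | ⟨j, -, rfl⟩)
    · by_cases h : b = a
      · subst h; exact Commute.refl _
      · exact pauliAt_commute (by simpa using h) _ _
    · exact pauliAt_commute (by simp) _ _
    · exact (pauliAt_inr_commute_factorOp _ _ _).symm
  V_commute := hV
  pauli_commute := by
    rintro _ ⟨q, hq, s, rfl⟩ g (⟨b, rfl⟩ | ⟨q', hq', s', rfl⟩ | ⟨j, hj, rfl⟩)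
    · exact pauliAt_commute (by simp) _ _
    · refine pauliAt_commute ?_ _ _
      rintro h
      exact hq' (Sum.inl_injective h ▸ hq)
    · exact (pauliAt_inl_commute_factorOp (fun i h => hJ j hj i (h ▸ hq)) s).symm
  pauli_sq := by
    rintro _ ⟨q, hq, s, rfl⟩
    exact pauliAt_sq _ _

variable {p}

section Block

variable {B : Finset (Fin n)} {J : Finset (Fin ℓ)} {V : QOp (ProtocolQubit n m r)}
  (hJ : ∀ j ∉ J, ∀ i, p.U.place j i ∉ B) (hV : ∀ g ∈ p.outerOps B J, Commute g V)

theorem isLocal_of_isPauliOn {R : QOp (ProtocolQubit n m r)}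
    (hR : IsPauliOn (B.map Function.Embedding.inl) R) : (p.qubitBlock B J V hJ hV).IsLocal R := by
  rintro g (⟨a, rfl⟩ | ⟨q, hq, s, rfl⟩ | ⟨j, hj, rfl⟩)
  · exact hR.commute_pauliAt (by simp) _
  · exact hR.commute_pauliAt (by simpa using hq) _
  · exact (hR.commute_embedOp _ (fun i => by simpa using hJ j hj i) _).symm

/-- The gates are sorted by what they touch: a Pauli on `B`, the factor in `J`, or only operators in
`outerOps`, in which case they commute with everything local to the block. -/
theorem circuit_labels (hVJ : ∀ j ∈ J, V = p.factorOp j) (l : List (GateLabel n m ℓ r)) :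
    (p.qubitBlock B J V hJ hV).Circuit (l.map p.gate) (l.countP (onQubits B))
      (l.countP (onFactors J)) := by
  induction l with
  | nil => exact .nil
  | cons g l ih =>
    have hanc : ∀ a, (Sum.inr a : ProtocolQubit n m r) ∈ (p.qubitBlock B J V hJ hV).anc :=
      fun a => ⟨a, rfl⟩
    rw [List.map_cons]
    rcases g with ⟨t, i, q⟩ | ⟨t, j⟩
    · rw [List.countP_cons_of_neg (p := onFactors J) (by simp [onFactors])]
      by_cases hq : q ∈ B
      · rw [List.countP_cons_of_pos (by simpa [onQubits] using hq)]
        exact .pauli (hanc _) ⟨q, hq, _, rfl⟩ (hasCost_ctrl_pauliAt _ (by simp [control])) ih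
      · rw [List.countP_cons_of_neg (by simpa [onQubits] using hq)]
        refine .idle (fun X hX => ?_) ih
        exact commute_ctrl (hX.commute_Z (hanc _)) (hX _ (Or.inr (Or.inl ⟨q, hq, _, rfl⟩)))
    · rw [List.countP_cons_of_neg (p := onQubits B) (by simp [onQubits])]
      by_cases hj : j ∈ J
      · rw [List.countP_cons_of_pos (by simpa [onFactors] using hj)]
        have : p.gate (.inr (t, j)) =
            ctrl (Sum.inr (t, none)) (p.qubitBlock B J V hJ hV).V := by
          rw [gate, target, ← hVJ j hj]
          rfl
        rw [this]
        exact .block (hanc _) ih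
      · rw [List.countP_cons_of_neg (by simpa [onFactors] using hj)]
        refine .idle (fun X hX => ?_) ih
        exact commute_ctrl (hX.commute_Z (hanc _)) (hX _ (Or.inr (Or.inr ⟨j, hj, rfl⟩)))

/-- Every commutator of a Pauli of the block with `V` is a Pauli of the block that commutes with
`V` up to sign. -/
def HasPauliCommutators (B : Finset (Fin n)) (V : QOp (ProtocolQubit n m r)) : Prop :=
  ∀ q ∈ B, ∀ s, ∃ R, IsPauliOn (B.map Function.Embedding.inl) R ∧
    pauliAt (Sum.inl q) s * V = V * (R * pauliAt (Sum.inl q) s) ∧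
    V * pauliAt (Sum.inl q) s = R * (pauliAt (Sum.inl q) s * V) ∧ SignCommute V R

theorem isGood_of_isPauliOn {R : QOp (ProtocolQubit n m r)}
    (hR : IsPauliOn (B.map Function.Embedding.inl) R) (h : SignCommute V R) :
    (p.qubitBlock B J V hJ hV).IsGood R := by
  refine ⟨isLocal_of_isPauliOn hJ hV hR, h, ?_⟩
  rintro _ ⟨q, -, s, rfl⟩
  exact (isPauli_pauliAt _ _).comm hR.isPauli

theorem isHead_V (hVp : HasPauliCommutators B V) (κ : ℕ) :
    (p.qubitBlock B J V hJ hV).IsHead V κ := by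
  refine QubitBlock.isHead_V κ ?_
  rintro _ ⟨q, hq, s, rfl⟩
  obtain ⟨R, hR, h1, -, h2⟩ := hVp q hq s
  exact ⟨R, isGood_of_isPauliOn hJ hV hR h2, h1⟩

theorem isHead_pauliAt (hVp : HasPauliCommutators B V) {q : Fin n} (hq : q ∈ B) (s : Pauli1) :
    (p.qubitBlock B J V hJ hV).IsHead (pauliAt (Sum.inl q) s) (4 * B.card + 20) := by
  obtain ⟨R, hR, -, h1, h2⟩ := hVp q hq s
  refine QubitBlock.isHead_pauli ⟨q, hq, s, rfl⟩ ?_ (isGood_of_isPauliOn hJ hV hR h2)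
    hR.isPauli h1 ?_
  · rintro _ ⟨q, -, s, rfl⟩
    exact isPauli_pauliAt _ _
  · rintro _ ⟨a, rfl⟩
    simpa using hR.hasCost_ctrl (a := Sum.inr a) (by simp)

end Block

/-- A bound, up to the factor `r ^ 2 * wq`, for the cost of an error on one block of at most `c`
qubits. -/
def blockCost (c : ℕ) : ℕ := cliffordCost c + 76 * c + 51

theorem cliffordCost_mono {k c : ℕ} (h : k ≤ c) : cliffordCost k ≤ cliffordCost c := by
  unfold cliffordCost
  gcongr

/-- Each term is at most a multiple of `r ^ 2 * w`: `n₀` gives `cliffordCost c + 7`, `48 * s` gives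
`48 * c`, `t * κ` gives `4 * c + 20`, and `24 * t * (s + t)` gives `24 * c + 24`. These add up to
`blockCost c`. -/
theorem block_cost_le {r w b c s t n₀ κ : ℕ} (hr : 0 < r) (hw : 0 < w) (hb : b ≤ c)
    (hs : s ≤ r * (b * w)) (ht : t ≤ r) (hn : n₀ ≤ cliffordCost c + 7) (hκ : κ ≤ 4 * c + 20) :
    n₀ + 48 * s + t * (κ + 24 * (s + t)) ≤ blockCost c * (r ^ 2 * w) := by
  have hs' : s ≤ r * (c * w) := hs.trans (by gcongr)
  have h1 : 1 ≤ r ^ 2 * w := Nat.mul_pos (pow_pos hr 2) hw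
  have h2 : r * (c * w) ≤ c * (r ^ 2 * w) := by
    nlinarith [Nat.mul_le_mul_left (c * w) (Nat.le_mul_of_pos_left r hr)]
  have h3 : t * κ ≤ (4 * c + 20) * (r ^ 2 * w) := by
    have : t ≤ r ^ 2 * w := by nlinarith [Nat.mul_le_mul ht (Nat.mul_pos hr hw)]
    nlinarith [Nat.mul_le_mul this hκ]
  have h4 : t * s ≤ c * (r ^ 2 * w) := (Nat.mul_le_mul ht hs').trans (le_of_eq (by ring))
  have h5 : t * t ≤ r ^ 2 * w := (Nat.mul_le_mul ht ht).trans (by nlinarith [pow_pos hr 2])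
  have h6 : (cliffordCost c + 7) * 1 ≤ (cliffordCost c + 7) * (r ^ 2 * w) :=
    Nat.mul_le_mul_left _ h1
  unfold blockCost
  nlinarith

/-- An error on one block propagates at bounded cost. -/
theorem propagate_block {c : ℕ} (hr : 0 < r) (hw : 0 < p.wq) {B : Finset (Fin n)}
    {J : Finset (Fin ℓ)} {V W : QOp (ProtocolQubit n m r)}
    (hJ : ∀ j ∉ J, ∀ i, p.U.place j i ∉ B) (hV : ∀ g ∈ p.outerOps B J, Commute g V)
    (hVJ : ∀ j ∈ J, V = p.factorOp j) (hJc : J.card ≤ 1) (hB : B.card ≤ c)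
    (hW : (p.qubitBlock B J V hJ hV).IsHead W (4 * B.card + 20))
    (hWc : HasCost W (cliffordCost c + 7)) {l : List (GateLabel n m ℓ r)} (hl : p.IsProper l) :
    ∃ E, evolve (l.map p.gate) * W = E * evolve (l.map p.gate) ∧
      HasCost E (blockCost c * (r ^ 2 * p.wq)) := by
  obtain ⟨E, hE, hc⟩ := hW.propagate (circuit_labels hJ hV hVJ l) hWc
  refine ⟨E, hE, hc.mono (block_cost_le hr hw hB (hl.countP_onQubits_le B) ?_ le_rfl (by omega))⟩
  exact (hl.countP_onFactors_le J).trans (by nlinarith)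

theorem factor_not_mem {j j' : Fin ℓ} (h : j' ∉ ({j} : Finset (Fin ℓ))) (i : Fin (p.U.k j')) :
    p.U.place j' i ∉ Finset.univ.map (p.U.place j) := by
  simp only [Finset.mem_map, Finset.mem_univ, true_and, not_exists]
  exact fun i' hi' => p.U.disjoint j j' (fun hj => h (by simp [hj])) i' i hi'

theorem commute_factorOp_of_outer (j : Fin ℓ) :
    ∀ g ∈ p.outerOps (Finset.univ.map (p.U.place j)) {j}, Commute g (p.factorOp j) := by
  rintro g (⟨a, rfl⟩ | ⟨q, hq, s, rfl⟩ | ⟨j', hj', rfl⟩)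
  · exact pauliAt_inr_commute_factorOp _ _ _
  · exact pauliAt_inl_commute_factorOp (fun i h => hq (by simp [← h])) _
  · exact factorOp_commute (by simpa using hj')

theorem hasPauliCommutators_factorOp (hU : p.U.op * p.U.op = 1) (j : Fin ℓ) :
    HasPauliCommutators (Finset.univ.map (p.U.place j)) (p.factorOp j) := by
  intro q hq s
  obtain ⟨i, -, rfl⟩ := Finset.mem_map.mp hq
  obtain ⟨k, hk⟩ := p.U.exists_sq_eq hU j
  obtain ⟨R, hR, h1, h2, h3⟩ := (p.U.psc j).1.exists_commutator hk (isPauli_pauliAt i s)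
    (pauliAt_sq i s)
  set f := (p.U.place j).trans (Function.Embedding.inl (β := Fin r × Option (Fin m))) with hf
  have hs : pauliAt (Sum.inl (p.U.place j i)) s = embedOp f (pauliAt i s) := by
    rw [embedOp_pauliAt]
    rfl
  refine ⟨embedOp f R, ?_, ?_, ?_, ?_⟩
  · rw [Finset.map_map]
    exact hR.embedOp f
  · rw [hs, factorOp, ← embedOp_mul, ← embedOp_mul, ← embedOp_mul, h1]
  · rw [hs, factorOp, ← embedOp_mul, ← embedOp_mul, ← embedOp_mul, h2]
  · rw [factorOp]
    unfold SignCommute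
    rw [← embedOp_mul, ← embedOp_mul, ← embedOp_neg]
    exact h3.imp (congrArg _) (congrArg _)

theorem propagate_factorOp {c : ℕ} (hc : ∀ i, p.U.k i ≤ c) (hU : p.U.op * p.U.op = 1)
    (hr : 0 < r) (hw : 0 < p.wq) (j : Fin ℓ) {l : List (GateLabel n m ℓ r)} (hl : p.IsProper l) :
    ∃ E, evolve (l.map p.gate) * p.factorOp j = E * evolve (l.map p.gate) ∧
      HasCost E (blockCost (c + 1) * (r ^ 2 * p.wq)) := by
  have : Nonempty (ProtocolQubit n m r) := ⟨Sum.inr (⟨0, hr⟩, none)⟩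
  refine propagate_block hr hw (B := Finset.univ.map (p.U.place j)) (J := {j})
    (fun j' h i => factor_not_mem h i) (commute_factorOp_of_outer j) (by simp) (by simp)
    ?_ (isHead_V _ _ (hasPauliCommutators_factorOp hU j) _) ?_ hl
  · simpa using (hc j).trans (Nat.le_succ c)
  · refine ((p.U.psc j).1.hasCost_embedOp _).mono ?_
    have : cliffordCost (p.U.k j) ≤ cliffordCost (c + 1) :=
      cliffordCost_mono ((hc j).trans (Nat.le_succ c))
    omega

theorem propagate_data {c : ℕ} (hc : ∀ i, p.U.k i ≤ c) (hU : p.U.op * p.U.op = 1)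
    (hr : 0 < r) (hw : 0 < p.wq) (q : Fin n) (s : Pauli1) {l : List (GateLabel n m ℓ r)}
    (hl : p.IsProper l) :
    ∃ E, evolve (l.map p.gate) * pauliAt (Sum.inl q) s = E * evolve (l.map p.gate) ∧
      HasCost E (blockCost (c + 1) * (r ^ 2 * p.wq)) := by
  have hcost : HasCost (pauliAt (Sum.inl q : ProtocolQubit n m r) s) (cliffordCost (c + 1) + 7) :=
    (hasCost_pauliAt _ _).mono (by omega)
  by_cases h : ∃ j i, p.U.place j i = q
  · obtain ⟨j, i, rfl⟩ := h
    refine propagate_block hr hw (B := Finset.univ.map (p.U.place j)) (J := {j})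
      (fun j' h i => factor_not_mem h i) (commute_factorOp_of_outer j) (by simp) (by simp)
      ?_ (isHead_pauliAt _ _ (hasPauliCommutators_factorOp hU j) (by simp) s) hcost hl
    simpa using (hc j).trans (Nat.le_succ c)
  -- A qubit outside all factors is a block by itself, with `V = 1`. This block has one qubit even
  -- if `c = 0`, which accounts for `c + 1` in the bound.
  · push Not at h
    refine propagate_block hr hw (B := {q}) (J := ∅) (V := 1) (fun j _ i => by simpa using h j i)
      (fun _ _ => Commute.one_right _) (by simp) (by simp) (by simp)
      (isHead_pauliAt _ _ ?_ (by simp) s) hcost hl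
    intro q' _ s'
    exact ⟨1, isPauliOn_one _, by simp, by simp, (Commute.one_left _).signCommute⟩

theorem propagate_target {c : ℕ} (hc : ∀ i, p.U.k i ≤ c) (hU : p.U.op * p.U.op = 1)
    (hr : 0 < r) (hw : 0 < p.wq) (g : GateLabel n m ℓ r) {l : List (GateLabel n m ℓ r)}
    (hl : p.IsProper l) :
    ∃ E, evolve (l.map p.gate) * p.target g = E * evolve (l.map p.gate) ∧
      HasCost E (blockCost (c + 1) * (r ^ 2 * p.wq)) := by
  rcases g with ⟨t, i, q⟩ | ⟨t, j⟩
  · exact propagate_data hc hU hr hw q _ hl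
  · exact propagate_factorOp hc hU hr hw j hl

/-! ### Propagation of ancilla errors -/

theorem commute_target (a : Fin r × Option (Fin m)) (s : Pauli1) (g : GateLabel n m ℓ r) :
    Commute (pauliAt (Sum.inr a) s) (p.target g) := by
  rcases g with ⟨t, i, q⟩ | ⟨t, j⟩
  · exact pauliAt_commute (by simp) _ _
  · exact pauliAt_inr_commute_factorOp _ _ _

theorem gate_commute_Z (g : GateLabel n m ℓ r) (a : Fin r × Option (Fin m)) :
    Commute (pauliAt (Sum.inr a) Pauli1.Z) (p.gate g) := by
  refine (commute_ctrl ?_ (commute_target a _ g).symm).symm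
  by_cases h : control g = Sum.inr a
  · rw [h]
  · exact pauliAt_commute h _ _

theorem gate_commute_pauliAt {g : GateLabel n m ℓ r} {a : Fin r × Option (Fin m)}
    (h : control g ≠ Sum.inr a) (s : Pauli1) : Commute (pauliAt (Sum.inr a) s) (p.gate g) :=
  (commute_ctrl (pauliAt_commute h _ _) (commute_target a _ g).symm).symm

theorem commute_evolve {X : QOp (ProtocolQubit n m r)} {l : List (GateLabel n m ℓ r)}
    (h : ∀ g ∈ l, Commute X (p.gate g)) : Commute X (evolve (l.map p.gate)) := by
  refine Commute.list_prod_right _ _ fun Y hY => ?_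
  rw [List.mem_reverse] at hY
  obtain ⟨g, hg, rfl⟩ := List.mem_map.mp hY
  exact h g hg

theorem target_sq (hU : p.U.op * p.U.op = 1) (g : GateLabel n m ℓ r) :
    ∃ k : ℕ, p.target g * p.target g = Complex.I ^ k • 1 := by
  rcases g with ⟨t, i, q⟩ | ⟨t, j⟩
  · exact ⟨0, by rw [pow_zero, one_smul]; exact pauliAt_sq _ _⟩
  · obtain ⟨k, hk⟩ := p.U.exists_sq_eq hU j
    exact ⟨k, by rw [target, factorOp, ← embedOp_mul, hk, embedOp_smul, embedOp_one]⟩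

/-- Every gate controlled by `a` emits its target as a fresh data error, which is propagated
separately through the later gates, and a phase gate of cost `12` that commutes with them. The `7`
pays for the `X` itself. -/
theorem propagate_ancilla_X {c : ℕ} (hc : ∀ i, p.U.k i ≤ c) (hU : p.U.op * p.U.op = 1)
    (hr : 0 < r) (hw : 0 < p.wq) (a : Fin r × Option (Fin m)) {l : List (GateLabel n m ℓ r)}
    (hl : p.IsProper l) :
    ∃ E, evolve (l.map p.gate) * pauliAt (Sum.inr a) Pauli1.X = E * evolve (l.map p.gate) ∧
      HasCost E (7 + l.countP (fun g => decide (control g = Sum.inr a)) *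
        (blockCost (c + 1) * (r ^ 2 * p.wq) + 12)) := by
  induction l with
  | nil =>
    refine ⟨pauliAt (Sum.inr a) Pauli1.X, ?_,
      (hasCost_pauliAt _ _).mono (Nat.le_add_right _ _)⟩
    simp [evolve_nil]
  | cons g l ih =>
    obtain ⟨E, hE, hcost⟩ := ih hl.of_cons
    rw [List.map_cons, evolve_cons]
    by_cases hg : control g = Sum.inr a
    · rw [List.countP_cons_of_pos (by simpa using hg)]
      obtain ⟨E', hE', hcost'⟩ := propagate_target hc hU hr hw g hl.of_cons
      obtain ⟨k, hk⟩ := target_sq hU g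
      -- The inverse phase is written as a natural power of `I`, the form that `hasCost_ctrl_phase`
      -- counts.
      have hinv : (Complex.I ^ k)⁻¹ = Complex.I ^ (3 * k) := by
        refine inv_eq_of_mul_eq_one_right ?_
        rw [← pow_add, show k + 3 * k = 4 * k by ring, pow_mul, Complex.I_pow_four, one_pow]
      set Φ : QOp (ProtocolQubit n m r) := ctrl (Sum.inr a) (Complex.I ^ (3 * k) • 1) with hΦ
      have hΦl : Commute Φ (evolve (l.map p.gate)) := commute_evolve fun g' _ =>
        commute_ctrl (gate_commute_Z g' a) ((Commute.one_left _).smul_left _)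
      have hX : p.gate g * pauliAt (Sum.inr a) Pauli1.X =
          pauliAt (Sum.inr a) Pauli1.X * p.target g * Φ * p.gate g := by
        rw [gate, hg, hΦ, ← hinv]
        exact pauliAt_X_mul_ctrl (pow_ne_zero _ Complex.I_ne_zero) hk (commute_target a _ g)
          (commute_target a _ g)
      refine ⟨E * E' * Φ, ?_, ((hcost.mul hcost').mul (hasCost_ctrl_phase _ _)).mono ?_⟩
      · rw [mul_assoc, hX, ← mul_assoc, ← mul_assoc, ← mul_assoc, hE, mul_assoc E, hE', mul_assoc,
          mul_assoc, mul_assoc, ← mul_assoc _ Φ, ← hΦl.eq]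
        simp only [mul_assoc]
      · rw [Nat.succ_mul]
        omega
    · rw [List.countP_cons_of_neg (by simpa using hg)]
      refine ⟨E, ?_, hcost⟩
      rw [mul_assoc, ← (gate_commute_pauliAt hg _).eq, ← mul_assoc, hE, mul_assoc]

theorem propagate {c : ℕ} (hc : ∀ i, p.U.k i ≤ c) (hU : p.U.op * p.U.op = 1)
    (hr : 0 < r) (hw : 0 < p.wq) (q : ProtocolQubit n m r) (s : Pauli1)
    {l : List (GateLabel n m ℓ r)} (hl : p.IsProper l) :
    ∃ E, evolve (l.map p.gate) * pauliAt q s = E * evolve (l.map p.gate) ∧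
      HasCost E ((blockCost (c + 1) + 27) * (r ^ 2 * p.wq * (p.wc + ℓ))) := by
  set T := blockCost (c + 1) with hT
  set N := r ^ 2 * p.wq with hN
  set w := p.wc + ℓ with hwdef
  have hN1 : 1 ≤ N := Nat.mul_pos (pow_pos hr 2) hw
  have hw1 : 1 ≤ w := (p.wc_pos hw).trans_le (Nat.le_add_right _ _)
  have hNw : 1 ≤ N * w := Nat.mul_pos hN1 hw1
  rcases q with q | a
  · obtain ⟨E, hE, hcost⟩ := propagate_data hc hU hr hw q s hl
    refine ⟨E, hE, hcost.mono ?_⟩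
    calc T * N ≤ T * (N * w) := Nat.mul_le_mul_left _ (Nat.le_mul_of_pos_right _ hw1)
      _ ≤ _ := Nat.mul_le_mul_right _ (Nat.le_add_right _ _)
  · have : Nonempty (ProtocolQubit n m r) := ⟨Sum.inr a⟩
    have hZ : Commute (pauliAt (Sum.inr a) Pauli1.Z) (evolve (l.map p.gate)) :=
      commute_evolve fun g _ => gate_commute_Z g a
    obtain ⟨E, hE, hcost⟩ := propagate_ancilla_X hc hU hr hw a hl
    -- Here `19 = 7 + 12`: the initial `X`, and one phase gate for each controlled gate.
    have hcost' : HasCost E ((T + 19) * (N * w)) := by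
      refine hcost.mono ?_
      calc _ ≤ 7 * (N * w) + w * (T * N + 12 * N) := by
            gcongr
            · omega
            · exact hl.countP_control_le _
            · omega
        _ = _ := by ring
    -- `Y` is `X` times `Z` up to the phase `I`; `Z` passes freely and costs `7`, the phase costs
    -- `1`. This raises `19` to `27`, the worst case.
    cases s
    · rw [pauliAt_I]
      exact ⟨1, by simp, hasCost_one.mono (Nat.zero_le _)⟩
    · exact ⟨E, hE, hcost'.mono (Nat.mul_le_mul_right _ (by omega))⟩
    · refine ⟨Complex.I • (E * pauliAt (Sum.inr a) Pauli1.Z), ?_,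
        ((hcost'.mul (hasCost_pauliAt _ _)).smul (by simp)).mono ?_⟩
      · rw [pauliAt_Y, mul_smul_comm, ← mul_assoc, hE, mul_assoc, ← hZ.eq, smul_mul_assoc,
          mul_assoc]
      · nlinarith
    · exact ⟨_, hZ.eq.symm, (hasCost_pauliAt _ _).mono (by nlinarith)⟩

end StandardProtocol

/-! ### The theorem -/

theorem theorem2 (c : ℕ) :
    ∃ K : ℕ, ∀ (n m ℓ r : ℕ) (p : StandardProtocol n m ℓ r),
      (∀ i, p.U.k i ≤ c) →
      p.U.op * p.U.op = 1 →
      0 < r →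
      0 < p.wq →
      ∀ (pre post : List (QOp (ProtocolQubit n m r))), p.gates = pre ++ post →
      ∀ (q : ProtocolQubit n m r) (s : Pauli1),
        ∃ C : List (QOp (ProtocolQubit n m r)),
          (∀ A ∈ C, IsOneTwoQubitClifford A) ∧
          IsClifford (evolve C) ∧
          evolve post * pauliAt q s * evolve pre = evolve C * evolve (pre ++ post) ∧
          C.length ≤ K * ((p.rS + p.rL) ^ 2 * p.wq * (p.wc + ℓ)) := by
  refine ⟨StandardProtocol.blockCost (c + 1) + 27, ?_⟩
  intro n m ℓ r p hc hU hr hw pre post hgates q s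
  rw [p.gates_eq_map_labels, List.map_eq_append_iff] at hgates
  obtain ⟨l, l', hl, -, rfl⟩ := hgates
  have hproper := p.isProper_labels
  rw [hl] at hproper
  -- The error is pushed through the later gates only; the earlier ones are multiplied back on the
  -- right.
  obtain ⟨E, hE, C, hC, rfl, hlen⟩ := StandardProtocol.propagate hc hU hr hw q s hproper.of_append
  refine ⟨C, fun A hA => (hC A hA).1, isClifford_evolve fun A hA => (hC A hA).2, ?_, ?_⟩
  · rw [hE, evolve_append, mul_assoc]
  · rw [p.rS_add_rL]
    exact hlen

end
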